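/- Types are built from propositional atoms, $\bot$ and $\mathsf{Bool}$ by $\to$ and $\wedge$; $\neg A:=A\to\bot$. A type is \emph{prime} if it is not a conjunction; every type is a conjunction of prime types, its \emph{prime factors}. $B$ is a \emph{strong subformula} of $A$ if it is a proper subformula of some prime proper subformula of $A$. \textbf{Calculi.} (i) The \emph{simply typed $\lambda$-calculus} has variables, abstraction, application, pairs $\langle u,v\rangle$, projections $u\,\pi_0,u\,\pi_1$, $\mathsf{efq}_P(u):P$ for $u:\bot$ and $P$ an atom or $\mathsf{Bool}$, constants $\mathsf T,\mathsf F:\mathsf{Bool}$, and $\mathsf{if}\ c\ \mathsf{then}\ u\ \mathsf{else}\ v$ at every type; reduction $\mapsto$ is generated, in all positions, by $(\lambda x\,u)t\mapsto u[t/x]$, $\langle u_0,u_1\rangle\pi_i\mapsto u_i$, $\mathsf{if}\ \mathsf T\ \mathsf{then}\ u\ \mathsf{else}\ v\mapsto u$ and $\mathsf{if}\ \mathsf F\ \mathsf{then}\ u\ \mathsf{else}\ v\mapsto v$. (ii) $\lambda_{\mathrm{CL}}$ has in addition the terms $u\parallel v:B$ for $u,v:B$, and $u\parallel_a v:B$,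 where $u:B$ may use the channel $a$ with type $\neg A$ (written $\bar a$) and $v:B$ may use $a$ with type $A$; $a$ is bound in $u\parallel_a v$. A \emph{context} $\mathcal C[\;]$ is a term with one hole, filled without renaming bound variables. The \emph{communication complexity} of $a$ in $u\parallel_a v:B$ is the maximum of $0$ and of the numbers of symbols of those prime factors of $A$ that are neither proper subformulas of $B$ nor strong subformulas of the type of a free variable of $u\parallel_a v$. In addition to the rules in (i), reduction is generated, in all positions, by the following rules (bound variables being renamed to avoid capture): \begin{itemize} \item $\parallel$ and $\parallel_a$ commute with the other constructors: $w(u\parallel_a v)\mapsto wu\parallel_a wv$; $(u\parallel_a v)\xi\mapsto u\xi\parallel_a v\xi$ for $\xi$ a term, a projection or $\mathsf{efq}_P$; $\lambda x(u\parallel_a v)\mapsto\lambda x\,u\parallel_a\lambda x\,v$; $\langle u\parallel_a v,w\rangle\mapsto\langle u,w\rangle\parallel_a\langle v,w\rangle$; $\langle w,u\parallel_a v\rangle\mapsto\langle w,u\rangle\parallel_a\langle w,v\rangle$; and the same rules with $\parallel$ in place of $\parallel_a$. \item If the communication complexity of $b$ in the term on the left is positive: $(u\parallel_a v)\parallel_b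 w\mapsto(u\parallel_b w)\parallel_a(v\parallel_b w)$ and $w\parallel_b(u\parallel_a v)\mapsto(w\parallel_b u)\parallel_a(w\parallel_b v)$, and the same rules with $\parallel$ in place of $\parallel_a$. \item $\mathcal C[\bar a\,u]\parallel_a\mathcal D\mapsto\mathcal D[u/a]$ if no free variable of $u$ is bound by $\mathcal C$, $a$ does not occur in $u$, and the communication complexity of $a$ is positive. \item $u\parallel_a v\mapsto u$ if $a$ does not occur in $u$, and $u\parallel_a v\mapsto v$ if $a$ does not occur in $v$. \item $(\dots\parallel\mathcal C[\bar a\,u]\parallel\dots)\parallel_a\mathcal D\mapsto(\mathcal C[\bar b\,\langle\vec y\rangle]\parallel_a\mathcal D)\parallel_b\mathcal D[u'/a]$, if $(\dots\parallel\mathcal C[\bar a\,u]\parallel\dots)$ is a parallel composition by $\parallel$ of normal simply typed terms, $\vec y$ is the non-empty sequence of the free variables of $u$ bound by $\mathcal C$, the displayed $a$ is its rightmost occurrence in $\mathcal C[\bar a\,u]$, the channel $b$ is fresh, of kind the conjunction of the types of $\vec y$, $u'$ is $u$ with each $y_i$ replaced by the corresponding projection of $b$, and the communication complexity of $a$ is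 positive. \end{itemize} (iii) \emph{Propositional $\lambda\mu$} has the constructs of (i) without $\mathsf{efq}$, together with $[\alpha]t:\bot$ for $t:A$ and $\mu\alpha.t:A$ for $t:\bot$, where $\alpha$ is a $\mu$-variable for $\neg A$. Reduction is generated, in all positions, by the rules in (i) and by $E[\mu\alpha.t]\mapsto\mu\alpha.\,t\{[\alpha]E[s]/[\alpha]s\}$ for $E$ an application $[\;]\,u$, a projection, or $\mathsf{if}\ [\;]\ \mathsf{then}\ u\ \mathsf{else}\ v$; by $[\beta]\mu\alpha.t\mapsto t[\beta/\alpha]$; and by $\mu\alpha.[\alpha]t\mapsto t$ if $\alpha$ does not occur in $t$. In each calculus $\mapsto^*$ is the reflexive-transitive closure of $\mapsto$, and a \emph{parallel OR} is a term $\mathsf O:\mathsf{Bool}\to\mathsf{Bool}\to\mathsf{Bool}$ such that $\mathsf O\,\mathsf F\,\mathsf F\mapsto^*\mathsf F$, and $\mathsf O\,u\,\mathsf T\mapsto^*\mathsf T$ and $\mathsf O\,\mathsf T\,u\mapsto^*\mathsf T$ for every term $u:\mathsf{Bool}$ of the calculus, open or closed. \textbf{Proposition.} $\lambda_{\mathrm{CL}}$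 is strictly more expressive than the simply typed $\lambda$-calculus and propositional $\lambda\mu$, in the following sense. \begin{enumerate} \item The inclusion of the simply typed terms in $\lambda_{\mathrm{CL}}$, as the terms without $\parallel$ and $\parallel_a$, is injective, and for a simply typed term $t$ the $\lambda_{\mathrm{CL}}$-terms $r$ with $t\mapsto r$ are exactly the simply typed terms $r$ with $t\mapsto r$ in the simply typed $\lambda$-calculus. \item $\lambda\mu$ embeds in the simply typed $\lambda$-calculus, hence in $\lambda_{\mathrm{CL}}$. Let $\underline{p}:=\neg p$ for atoms $p$, $\underline{\bot}:=\bot$, $\underline{\mathsf{Bool}}:=\neg\neg\mathsf{Bool}$, $\underline{A\to B}:=\underline A\to\underline B$ and $\underline{A\wedge B}:=\underline A\wedge\underline B$. There is a translation of the $\lambda\mu$-terms $t:A$ without free $\mu$-variables, with free variables $x_i:A_i$, into simply typed terms $\underline t:\underline A$ with free variables $x_i:\underline{A_i}$, such that $\underline x=x$, $\underline{\lambda x\,t}=\lambda x\,\underline t$, $\underline{t\,u}=\underline t\;\underline u$, $\underline{\langle t,u\rangle}=\langle\underline t,\underline u\rangle$, $\underline{t\,\pi_i}=\underline t\,\pi_i$,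 $\underline{\mathsf T}=\lambda k.\,k\,\mathsf T$, $\underline{\mathsf F}=\lambda k.\,k\,\mathsf F$, and such that $t\mapsto u$ implies that $\underline t$ and $\underline u$ are convertible in the simply typed $\lambda$-calculus, where convertibility is the congruence generated by $\mapsto$, $\lambda x.\,t\,x=t$ ($x$ not free in $t$) and $\langle t\,\pi_0,t\,\pi_1\rangle=t$. \item There is a closed $\lambda_{\mathrm{CL}}$-term that is a parallel OR. \item There is no parallel OR in the simply typed $\lambda$-calculus, even among open terms. \item There is no parallel OR in propositional $\lambda\mu$, even among open terms. \end{enumerate} -/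

import Mathlib

namespace ParCalc

/-! ## Types, de Bruijn variables, renamings -/

/-- Propositional formulas = types: atoms, falsum, the Boolean type, implication, conjunction. -/
inductive Ty : Type
  | atom : ℕ → Ty
  | bot : Ty
  | bool : Ty
  | arr : Ty → Ty → Ty
  | and : Ty → Ty → Ty

namespace Ty

/-- Negation `¬ A` is `A → ⊥`. -/
abbrev neg (A : Ty) : Ty := arr A bot

/-- Atomic types other than falsum (the types at which ex falso is available). -/
def IsAtomic : Ty → Prop
  | atom _ => True
  | bool => True
  | _ => False

/-- A formula is prime if it is not a conjunction. -/
def IsPrime : Ty → Prop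
  | and _ _ => False
  | _ => True

/-- The prime factors of a formula. -/
def primeFactors : Ty → List Ty
  | and A B => primeFactors A ++ primeFactors B
  | A => [A]

/-- Number of symbols of a formula. -/
def size : Ty → ℕ
  | arr A B => size A + size B + 1
  | and A B => size A + size B + 1
  | _ => 1

/-- `Subf B A`: `B` is a subformula of `A`. -/
inductive Subf : Ty → Ty → Prop
  | refl (A : Ty) : Subf A A
  | arrL {B A C : Ty} : Subf B A → Subf B (arr A C)
  | arrR {B A C : Ty} : Subf B C → Subf B (arr A C)
  | andL {B A C : Ty} : Subf B A → Subf B (and A C)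
  | andR {B A C : Ty} : Subf B C → Subf B (and A C)

/-- `B` is a proper subformula of `A`. -/
def ProperSubf (B A : Ty) : Prop := Subf B A ∧ B ≠ A

/-- `B` is a strong subformula of `A`: a proper subformula of a prime proper subformula of `A`. -/
def StrongSubf (B A : Ty) : Prop := ∃ C : Ty, IsPrime C ∧ ProperSubf C A ∧ ProperSubf B C

/-- The conjunction `A ∧ A₁ ∧ … ∧ Aₙ` of a non-empty list of formulas, associated to the right. -/
def conj : Ty → List Ty → Ty
  | A, [] => A
  | A, B :: l => and A (conj B l)

end Ty

/-- Typed de Bruijn variables. -/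
inductive Var : List Ty → Ty → Type
  | z {Γ : List Ty} {A : Ty} : Var (A :: Γ) A
  | s {Γ : List Ty} {A B : Ty} : Var Γ A → Var (B :: Γ) A

namespace Var

/-- The de Bruijn index of a variable. -/
def idx {Γ : List Ty} {A : Ty} : Var Γ A → ℕ
  | z => 0
  | s x => x.idx + 1

/-- Variables of `Γ ++ Δ` coming from `Γ`. -/
def inl {Δ : List Ty} {Γ : List Ty} {A : Ty} : Var Γ A → Var (Γ ++ Δ) A
  | z => z
  | s x => s (inl x)

/-- Variables of `Γ ++ Δ` coming from `Δ`. -/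
def inr {Δ : List Ty} : (Γ : List Ty) → {A : Ty} → Var Δ A → Var (Γ ++ Δ) A
  | [], _, x => x
  | _ :: Γ, _, x => s (inr Γ x)

/-- Case distinction on a variable of `Γ ++ Δ`. -/
def split {Δ : List Ty} : (Γ : List Ty) → {A : Ty} → Var (Γ ++ Δ) A → Var Γ A ⊕ Var Δ A
  | [], _, x => Sum.inr x
  | _ :: _, _, z => Sum.inl z
  | _ :: Γ, _, s x => (split Γ x).map s id

/-- Action of a map of types on variables. -/
def mapTy (f : Ty → Ty) {Γ : List Ty} {A : Ty} : Var Γ A → Var (Γ.map f) (f A)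
  | z => z
  | s x => s (mapTy f x)

end Var

/-- Renamings. -/
abbrev Ren (Γ Δ : List Ty) : Type := ∀ ⦃A : Ty⦄, Var Γ A → Var Δ A

namespace Ren

/-- Extension of a renaming under a binder. -/
def lift {Γ Δ : List Ty} (ρ : Ren Γ Δ) (C : Ty) : Ren (C :: Γ) (C :: Δ)
  | _, Var.z => Var.z
  | _, Var.s x => Var.s (ρ x)

/-- Weakening by one variable. -/
def wk {Γ : List Ty} (C : Ty) : Ren Γ (C :: Γ) := fun _ x => Var.s x

/-- Exchange of the two innermost variables. -/
def swap {Γ : List Ty} {C D : Ty} : Ren (C :: D :: Γ) (D :: C :: Γ)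
  | _, Var.z => Var.s Var.z
  | _, Var.s Var.z => Var.z
  | _, Var.s (Var.s x) => Var.s (Var.s x)

/-- Instantiation of the innermost variable by another variable. -/
def inst {Γ : List Ty} {C : Ty} (y : Var Γ C) : Ren (C :: Γ) Γ
  | _, Var.z => y
  | _, Var.s x => x

end Ren

/-! ## The simply typed lambda-calculus with conjunction, ex falso and Booleans -/

/-- `Lam Γ A`: simply typed terms of type `A` with free variables in `Γ`. -/
inductive Lam : List Ty → Ty → Type
  | var {Γ : List Ty} {A : Ty} : Var Γ A → Lam Γ A
  | lam {Γ : List Ty} {A B : Ty} : Lam (A :: Γ) B → Lam Γ (Ty.arr A B)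
  | app {Γ : List Ty} {A B : Ty} : Lam Γ (Ty.arr A B) → Lam Γ A → Lam Γ B
  | pair {Γ : List Ty} {A B : Ty} : Lam Γ A → Lam Γ B → Lam Γ (Ty.and A B)
  | fst {Γ : List Ty} {A B : Ty} : Lam Γ (Ty.and A B) → Lam Γ A
  | snd {Γ : List Ty} {A B : Ty} : Lam Γ (Ty.and A B) → Lam Γ B
  | efq {Γ : List Ty} (P : Ty) (hP : P.IsAtomic) : Lam Γ Ty.bot → Lam Γ P
  | tt {Γ : List Ty} : Lam Γ Ty.bool
  | ff {Γ : List Ty} : Lam Γ Ty.bool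
  | ite {Γ : List Ty} {A : Ty} : Lam Γ Ty.bool → Lam Γ A → Lam Γ A → Lam Γ A

namespace Lam

def rename {Γ : List Ty} {A : Ty} : Lam Γ A → {Δ : List Ty} → Ren Γ Δ → Lam Δ A
  | var x, _, ρ => var (ρ x)
  | lam t, _, ρ => lam (t.rename (ρ.lift _))
  | app t u, _, ρ => app (t.rename ρ) (u.rename ρ)
  | pair t u, _, ρ => pair (t.rename ρ) (u.rename ρ)
  | fst t, _, ρ => fst (t.rename ρ)
  | snd t, _, ρ => snd (t.rename ρ)
  | efq P hP t, _, ρ => efq P hP (t.rename ρ)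
  | tt, _, _ => tt
  | ff, _, _ => ff
  | ite c t u, _, ρ => ite (c.rename ρ) (t.rename ρ) (u.rename ρ)

/-- Simultaneous substitutions. -/
abbrev Sub (Γ Δ : List Ty) : Type := ∀ ⦃A : Ty⦄, Var Γ A → Lam Δ A

def Sub.lift {Γ Δ : List Ty} (σ : Sub Γ Δ) (C : Ty) : Sub (C :: Γ) (C :: Δ)
  | _, Var.z => var Var.z
  | _, Var.s x => (σ x).rename (Ren.wk C)

def subst {Γ : List Ty} {A : Ty} : Lam Γ A → {Δ : List Ty} → Sub Γ Δ → Lam Δ A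
  | var x, _, σ => σ x
  | lam t, _, σ => lam (t.subst (Sub.lift σ _))
  | app t u, _, σ => app (t.subst σ) (u.subst σ)
  | pair t u, _, σ => pair (t.subst σ) (u.subst σ)
  | fst t, _, σ => fst (t.subst σ)
  | snd t, _, σ => snd (t.subst σ)
  | efq P hP t, _, σ => efq P hP (t.subst σ)
  | tt, _, _ => tt
  | ff, _, _ => ff
  | ite c t u, _, σ => ite (c.subst σ) (t.subst σ) (u.subst σ)

/-- The substitution replacing the innermost variable by `u`. -/
def Sub.single {Γ : List Ty} {C : Ty} (u : Lam Γ C) : Sub (C :: Γ) Γ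
  | _, Var.z => u
  | _, Var.s x => var x

/-- One-step reduction, in arbitrary position. -/
inductive Step : {Γ : List Ty} → {A : Ty} → Lam Γ A → Lam Γ A → Prop
  | beta {Γ : List Ty} {A B : Ty} (t : Lam (A :: Γ) B) (u : Lam Γ A) :
      Step (app (lam t) u) (t.subst (Sub.single u))
  | fst_pair {Γ : List Ty} {A B : Ty} (t : Lam Γ A) (u : Lam Γ B) : Step (fst (pair t u)) t
  | snd_pair {Γ : List Ty} {A B : Ty} (t : Lam Γ A) (u : Lam Γ B) : Step (snd (pair t u)) u
  | ite_tt {Γ : List Ty} {A : Ty} (t u : Lam Γ A) : Step (ite tt t u) t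
  | ite_ff {Γ : List Ty} {A : Ty} (t u : Lam Γ A) : Step (ite ff t u) u
  | lam {Γ : List Ty} {A B : Ty} {t t' : Lam (A :: Γ) B} : Step t t' → Step (lam t) (lam t')
  | appL {Γ : List Ty} {A B : Ty} {t t' : Lam Γ (Ty.arr A B)} {u : Lam Γ A} :
      Step t t' → Step (app t u) (app t' u)
  | appR {Γ : List Ty} {A B : Ty} {t : Lam Γ (Ty.arr A B)} {u u' : Lam Γ A} :
      Step u u' → Step (app t u) (app t u')
  | pairL {Γ : List Ty} {A B : Ty} {t t' : Lam Γ A} {u : Lam Γ B} :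
      Step t t' → Step (pair t u) (pair t' u)
  | pairR {Γ : List Ty} {A B : Ty} {t : Lam Γ A} {u u' : Lam Γ B} :
      Step u u' → Step (pair t u) (pair t u')
  | fst {Γ : List Ty} {A B : Ty} {t t' : Lam Γ (Ty.and A B)} : Step t t' → Step (fst t) (fst t')
  | snd {Γ : List Ty} {A B : Ty} {t t' : Lam Γ (Ty.and A B)} : Step t t' → Step (snd t) (snd t')
  | efq {Γ : List Ty} {P : Ty} {hP : P.IsAtomic} {t t' : Lam Γ Ty.bot} :
      Step t t' → Step (efq P hP t) (efq P hP t')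
  | iteC {Γ : List Ty} {A : Ty} {c c' : Lam Γ Ty.bool} {t u : Lam Γ A} :
      Step c c' → Step (ite c t u) (ite c' t u)
  | iteT {Γ : List Ty} {A : Ty} {c : Lam Γ Ty.bool} {t t' u : Lam Γ A} :
      Step t t' → Step (ite c t u) (ite c t' u)
  | iteE {Γ : List Ty} {A : Ty} {c : Lam Γ Ty.bool} {t u u' : Lam Γ A} :
      Step u u' → Step (ite c t u) (ite c t u')

/-- Many-step reduction. -/
def Steps {Γ : List Ty} {A : Ty} : Lam Γ A → Lam Γ A → Prop := Relation.ReflTransGen Step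

/-- Normal terms. -/
def Normal {Γ : List Ty} {A : Ty} (t : Lam Γ A) : Prop := ∀ t' : Lam Γ A, ¬ Step t t'

/-- Convertibility: the congruence generated by reduction and the two extensionality rules
(eta for functions, surjective pairing). -/
inductive Conv : {Γ : List Ty} → {A : Ty} → Lam Γ A → Lam Γ A → Prop
  | step {Γ : List Ty} {A : Ty} {t u : Lam Γ A} : Step t u → Conv t u
  | eta {Γ : List Ty} {A B : Ty} (t : Lam Γ (Ty.arr A B)) :
      Conv (lam (app (t.rename (Ren.wk A)) (var Var.z))) t
  | surj {Γ : List Ty} {A B : Ty} (t : Lam Γ (Ty.and A B)) : Conv (pair (fst t) (snd t)) t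
  | refl {Γ : List Ty} {A : Ty} (t : Lam Γ A) : Conv t t
  | symm {Γ : List Ty} {A : Ty} {t u : Lam Γ A} : Conv t u → Conv u t
  | trans {Γ : List Ty} {A : Ty} {t u v : Lam Γ A} : Conv t u → Conv u v → Conv t v
  | lam {Γ : List Ty} {A B : Ty} {t t' : Lam (A :: Γ) B} : Conv t t' → Conv (lam t) (lam t')
  | app {Γ : List Ty} {A B : Ty} {t t' : Lam Γ (Ty.arr A B)} {u u' : Lam Γ A} :
      Conv t t' → Conv u u' → Conv (app t u) (app t' u')
  | pair {Γ : List Ty} {A B : Ty} {t t' : Lam Γ A} {u u' : Lam Γ B} :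
      Conv t t' → Conv u u' → Conv (pair t u) (pair t' u')
  | fst {Γ : List Ty} {A B : Ty} {t t' : Lam Γ (Ty.and A B)} : Conv t t' → Conv (fst t) (fst t')
  | snd {Γ : List Ty} {A B : Ty} {t t' : Lam Γ (Ty.and A B)} : Conv t t' → Conv (snd t) (snd t')
  | efq {Γ : List Ty} {P : Ty} {hP : P.IsAtomic} {t t' : Lam Γ Ty.bot} :
      Conv t t' → Conv (efq P hP t) (efq P hP t')
  | ite {Γ : List Ty} {A : Ty} {c c' : Lam Γ Ty.bool} {t t' u u' : Lam Γ A} :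
      Conv c c' → Conv t t' → Conv u u' → Conv (ite c t u) (ite c' t' u')

/-- `O` is a parallel OR: `O F F ↦* F`, and `O u T ↦* T`, `O T u ↦* T` for every term `u`,
where `u` may have arbitrary further free variables. -/
def IsParallelOr {Γ : List Ty} (O : Lam Γ (Ty.arr Ty.bool (Ty.arr Ty.bool Ty.bool))) : Prop :=
  Steps (app (app O ff) ff) ff ∧
  ∀ (Δ : List Ty) (ρ : Ren Γ Δ) (u : Lam Δ Ty.bool),
    Steps (app (app (O.rename ρ) u) tt) tt ∧ Steps (app (app (O.rename ρ) tt) u) tt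

end Lam

/-! ## The parallel calculus for classical logic -/

/-- `CL Γ B`: terms of type `B` with free variables in `Γ`. `par u v` is contraction `u ∥ v`;
`em u v` is `u ∥_a v`, binding the channel `a` with type `¬ A` in `u` and type `A` in `v`. -/
inductive CL : List Ty → Ty → Type
  | var {Γ : List Ty} {A : Ty} : Var Γ A → CL Γ A
  | lam {Γ : List Ty} {A B : Ty} : CL (A :: Γ) B → CL Γ (Ty.arr A B)
  | app {Γ : List Ty} {A B : Ty} : CL Γ (Ty.arr A B) → CL Γ A → CL Γ B
  | pair {Γ : List Ty} {A B : Ty} : CL Γ A → CL Γ B → CL Γ (Ty.and A B)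
  | fst {Γ : List Ty} {A B : Ty} : CL Γ (Ty.and A B) → CL Γ A
  | snd {Γ : List Ty} {A B : Ty} : CL Γ (Ty.and A B) → CL Γ B
  | efq {Γ : List Ty} (P : Ty) (hP : P.IsAtomic) : CL Γ Ty.bot → CL Γ P
  | tt {Γ : List Ty} : CL Γ Ty.bool
  | ff {Γ : List Ty} : CL Γ Ty.bool
  | ite {Γ : List Ty} {A : Ty} : CL Γ Ty.bool → CL Γ A → CL Γ A → CL Γ A
  | par {Γ : List Ty} {A : Ty} : CL Γ A → CL Γ A → CL Γ A
  | em {Γ : List Ty} {A B : Ty} : CL (Ty.neg A :: Γ) B → CL (A :: Γ) B → CL Γ B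

/-- The inclusion of simply typed terms as the terms without parallel operators. -/
def Lam.toCL {Γ : List Ty} {A : Ty} : Lam Γ A → CL Γ A
  | Lam.var x => CL.var x
  | Lam.lam t => CL.lam t.toCL
  | Lam.app t u => CL.app t.toCL u.toCL
  | Lam.pair t u => CL.pair t.toCL u.toCL
  | Lam.fst t => CL.fst t.toCL
  | Lam.snd t => CL.snd t.toCL
  | Lam.efq P hP t => CL.efq P hP t.toCL
  | Lam.tt => CL.tt
  | Lam.ff => CL.ff
  | Lam.ite c t u => CL.ite c.toCL t.toCL u.toCL

namespace CL

def rename {Γ : List Ty} {A : Ty} : CL Γ A → {Δ : List Ty} → Ren Γ Δ → CL Δ A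
  | var x, _, ρ => var (ρ x)
  | lam t, _, ρ => lam (t.rename (ρ.lift _))
  | app t u, _, ρ => app (t.rename ρ) (u.rename ρ)
  | pair t u, _, ρ => pair (t.rename ρ) (u.rename ρ)
  | fst t, _, ρ => fst (t.rename ρ)
  | snd t, _, ρ => snd (t.rename ρ)
  | efq P hP t, _, ρ => efq P hP (t.rename ρ)
  | tt, _, _ => tt
  | ff, _, _ => ff
  | ite c t u, _, ρ => ite (c.rename ρ) (t.rename ρ) (u.rename ρ)
  | par t u, _, ρ => par (t.rename ρ) (u.rename ρ)
  | em t u, _, ρ => em (t.rename (ρ.lift _)) (u.rename (ρ.lift _))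

/-- Weakening by one variable. -/
def wk {Γ : List Ty} {A : Ty} (C : Ty) (t : CL Γ A) : CL (C :: Γ) A := t.rename (Ren.wk C)

/-- Simultaneous substitutions. -/
abbrev Sub (Γ Δ : List Ty) : Type := ∀ ⦃A : Ty⦄, Var Γ A → CL Δ A

def Sub.lift {Γ Δ : List Ty} (σ : Sub Γ Δ) (C : Ty) : Sub (C :: Γ) (C :: Δ)
  | _, Var.z => var Var.z
  | _, Var.s x => (σ x).wk C

def subst {Γ : List Ty} {A : Ty} : CL Γ A → {Δ : List Ty} → Sub Γ Δ → CL Δ A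
  | var x, _, σ => σ x
  | lam t, _, σ => lam (t.subst (Sub.lift σ _))
  | app t u, _, σ => app (t.subst σ) (u.subst σ)
  | pair t u, _, σ => pair (t.subst σ) (u.subst σ)
  | fst t, _, σ => fst (t.subst σ)
  | snd t, _, σ => snd (t.subst σ)
  | efq P hP t, _, σ => efq P hP (t.subst σ)
  | tt, _, _ => tt
  | ff, _, _ => ff
  | ite c t u, _, σ => ite (c.subst σ) (t.subst σ) (u.subst σ)
  | par t u, _, σ => par (t.subst σ) (u.subst σ)
  | em t u, _, σ => em (t.subst (Sub.lift σ _)) (u.subst (Sub.lift σ _))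

/-- The substitution replacing the innermost variable by `u`. -/
def Sub.single {Γ : List Ty} {C : Ty} (u : CL Γ C) : Sub (C :: Γ) Γ
  | _, Var.z => u
  | _, Var.s x => var x

/-- `t.Occ n`: the variable with de Bruijn index `n` occurs free in `t`. -/
def Occ {Γ : List Ty} {A : Ty} : CL Γ A → ℕ → Prop
  | var x, n => x.idx = n
  | lam t, n => t.Occ (n + 1)
  | app t u, n => t.Occ n ∨ u.Occ n
  | pair t u, n => t.Occ n ∨ u.Occ n
  | fst t, n => t.Occ n
  | snd t, n => t.Occ n
  | efq _ _ t, n => t.Occ n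
  | tt, _ => False
  | ff, _ => False
  | ite c t u, n => c.Occ n ∨ t.Occ n ∨ u.Occ n
  | par t u, n => t.Occ n ∨ u.Occ n
  | em t u, n => t.Occ (n + 1) ∨ u.Occ (n + 1)

/-- The set of types of the free variables of a term. -/
def freeTypes {Γ : List Ty} {A : Ty} (t : CL Γ A) : Set Ty :=
  {C | ∃ x : Var Γ C, t.Occ x.idx}

open Classical in
/-- The communication complexity of the channel of `u ∥_a v : B` with communication kind `A`:
the maximum of `0` and the numbers of symbols of the prime factors of `A` that are neither proper
subformulas of `B` nor strong subformulas of the type of a free variable of `u ∥_a v`. -/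
noncomputable def commComplexity {Γ : List Ty} {A B : Ty}
    (u : CL (Ty.neg A :: Γ) B) (v : CL (A :: Γ) B) : ℕ :=
  ((A.primeFactors.filter fun F =>
      decide (¬ F.ProperSubf B ∧ ∀ C ∈ (em u v).freeTypes, ¬ F.StrongSubf C)).map
    Ty.size).foldr max 0

/-- `Ctx Δ H Γ A`: contexts, i.e. terms of type `A` with free variables in `Γ` and exactly one
hole, of type `H`; `Δ` lists the variables in scope at the hole (those of `Γ` and those bound by
the context above the hole), which may be captured. -/
inductive Ctx (Δ : List Ty) (H : Ty) : List Ty → Ty → Type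
  | hole : Ctx Δ H Δ H
  | lam {Γ : List Ty} {A B : Ty} : Ctx Δ H (A :: Γ) B → Ctx Δ H Γ (Ty.arr A B)
  | appL {Γ : List Ty} {A B : Ty} : Ctx Δ H Γ (Ty.arr A B) → CL Γ A → Ctx Δ H Γ B
  | appR {Γ : List Ty} {A B : Ty} : CL Γ (Ty.arr A B) → Ctx Δ H Γ A → Ctx Δ H Γ B
  | pairL {Γ : List Ty} {A B : Ty} : Ctx Δ H Γ A → CL Γ B → Ctx Δ H Γ (Ty.and A B)
  | pairR {Γ : List Ty} {A B : Ty} : CL Γ A → Ctx Δ H Γ B → Ctx Δ H Γ (Ty.and A B)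
  | fst {Γ : List Ty} {A B : Ty} : Ctx Δ H Γ (Ty.and A B) → Ctx Δ H Γ A
  | snd {Γ : List Ty} {A B : Ty} : Ctx Δ H Γ (Ty.and A B) → Ctx Δ H Γ B
  | efq {Γ : List Ty} (P : Ty) (hP : P.IsAtomic) : Ctx Δ H Γ Ty.bot → Ctx Δ H Γ P
  | iteC {Γ : List Ty} {A : Ty} : Ctx Δ H Γ Ty.bool → CL Γ A → CL Γ A → Ctx Δ H Γ A
  | iteT {Γ : List Ty} {A : Ty} : CL Γ Ty.bool → Ctx Δ H Γ A → CL Γ A → Ctx Δ H Γ A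
  | iteE {Γ : List Ty} {A : Ty} : CL Γ Ty.bool → CL Γ A → Ctx Δ H Γ A → Ctx Δ H Γ A
  | parL {Γ : List Ty} {A : Ty} : Ctx Δ H Γ A → CL Γ A → Ctx Δ H Γ A
  | parR {Γ : List Ty} {A : Ty} : CL Γ A → Ctx Δ H Γ A → Ctx Δ H Γ A
  | emL {Γ : List Ty} {A B : Ty} : Ctx Δ H (Ty.neg A :: Γ) B → CL (A :: Γ) B → Ctx Δ H Γ B
  | emR {Γ : List Ty} {A B : Ty} : CL (Ty.neg A :: Γ) B → Ctx Δ H (A :: Γ) B → Ctx Δ H Γ B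

namespace Ctx

/-- `C[t]`. -/
def plug {Δ : List Ty} {H : Ty} {Γ : List Ty} {A : Ty} : Ctx Δ H Γ A → CL Δ H → CL Γ A
  | hole, t => t
  | lam C, t => CL.lam (C.plug t)
  | appL C u, t => CL.app (C.plug t) u
  | appR u C, t => CL.app u (C.plug t)
  | pairL C u, t => CL.pair (C.plug t) u
  | pairR u C, t => CL.pair u (C.plug t)
  | fst C, t => CL.fst (C.plug t)
  | snd C, t => CL.snd (C.plug t)
  | efq P hP C, t => CL.efq P hP (C.plug t)
  | iteC C u v, t => CL.ite (C.plug t) u v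
  | iteT c C v, t => CL.ite c (C.plug t) v
  | iteE c u C, t => CL.ite c u (C.plug t)
  | parL C u, t => CL.par (C.plug t) u
  | parR u C, t => CL.par u (C.plug t)
  | emL C u, t => CL.em (C.plug t) u
  | emR u C, t => CL.em u (C.plug t)

/-- The variables free in the context, seen from inside the hole. A variable at the hole is bound
by the context iff it is not in the range of this renaming. -/
def emb {Δ : List Ty} {H : Ty} {Γ : List Ty} {A : Ty} : Ctx Δ H Γ A → Ren Γ Δ
  | hole => fun _ x => x
  | lam C => fun _ x => C.emb (Var.s x)
  | appL C _ => C.emb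
  | appR _ C => C.emb
  | pairL C _ => C.emb
  | pairR _ C => C.emb
  | fst C => C.emb
  | snd C => C.emb
  | efq _ _ C => C.emb
  | iteC C _ _ => C.emb
  | iteT _ C _ => C.emb
  | iteE _ _ C => C.emb
  | parL C _ => C.emb
  | parR _ C => C.emb
  | emL C _ => fun _ x => C.emb (Var.s x)
  | emR _ C => fun _ x => C.emb (Var.s x)

/-- The variable with index `n` does not occur to the right of the hole. -/
def RightFree {Δ : List Ty} {H : Ty} {Γ : List Ty} {A : Ty} : Ctx Δ H Γ A → ℕ → Prop
  | hole, _ => True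
  | lam C, n => C.RightFree (n + 1)
  | appL C u, n => C.RightFree n ∧ ¬ u.Occ n
  | appR _ C, n => C.RightFree n
  | pairL C u, n => C.RightFree n ∧ ¬ u.Occ n
  | pairR _ C, n => C.RightFree n
  | fst C, n => C.RightFree n
  | snd C, n => C.RightFree n
  | efq _ _ C, n => C.RightFree n
  | iteC C u v, n => C.RightFree n ∧ ¬ u.Occ n ∧ ¬ v.Occ n
  | iteT _ C v, n => C.RightFree n ∧ ¬ v.Occ n
  | iteE _ _ C, n => C.RightFree n
  | parL C u, n => C.RightFree n ∧ ¬ u.Occ n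
  | parR _ C, n => C.RightFree n
  | emL C u, n => C.RightFree (n + 1) ∧ ¬ u.Occ (n + 1)
  | emR _ C, n => C.RightFree (n + 1)

end Ctx

/-- The parallel components `t₁, …, tₙ` of `t₁ ∥ … ∥ tₙ`. -/
def components {Γ : List Ty} {A : Ty} : CL Γ A → List (CL Γ A)
  | par t u => t.components ++ u.components
  | t => [t]

/-- Normal simple parallel terms `t₁ ∥ … ∥ tₙ`: every `tᵢ` is a normal simply typed term. (No
reduction rule applies to a contraction of simply typed terms as such, so that such a term is
normal as soon as its components are.) -/
def NormalSimpleParallel {Γ : List Ty} {A : Ty} (t : CL Γ A) : Prop :=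
  ∀ r ∈ t.components, ∃ s : Lam Γ A, s.Normal ∧ s.toCL = r

/-- The tuple of a non-empty family of terms. -/
def tuple {Δ : List Ty} : (Y : Ty) → (Ys : List Ty) →
    (∀ ⦃C : Ty⦄, Var (Y :: Ys) C → CL Δ C) → CL Δ (Ty.conj Y Ys)
  | _, [], f => f Var.z
  | _, Z :: Zs, f => pair (f Var.z) (tuple Z Zs fun _ x => f (Var.s x))

/-- The projections of a term whose type is the conjunction of a non-empty list of types. -/
def projs {Δ : List Ty} : (Y : Ty) → (Ys : List Ty) → CL Δ (Ty.conj Y Ys) →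
    ∀ ⦃C : Ty⦄, Var (Y :: Ys) C → CL Δ C
  | _, [], b, _, Var.z => b
  | _, _ :: _, b, _, Var.z => fst b
  | _, Z :: Zs, b, _, Var.s x => projs Z Zs (snd b) x

/-- The multiple substitution replacing the variables `Y :: Ys` by the projections of the
innermost variable `b` and leaving those of `Γ` unchanged. -/
def multiSub {Γ : List Ty} (Y : Ty) (Ys : List Ty) :
    Sub ((Y :: Ys) ++ Γ) (Ty.conj Y Ys :: Γ) := fun _ x =>
  match Var.split (Y :: Ys) x with
  | Sum.inl y => projs Y Ys (var Var.z) y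
  | Sum.inr x => var (Var.s x)

/-- Substitution of the innermost variable of `A :: Γ` by a term over `C :: Γ`. -/
def replaceTop {Γ : List Ty} {A C : Ty} (u : CL (C :: Γ) A) : Sub (A :: Γ) (C :: Γ)
  | _, Var.z => u
  | _, Var.s x => var (Var.s x)

/-- The basic reduction rules, at the root of a term. -/
inductive Red : {Γ : List Ty} → {A : Ty} → CL Γ A → CL Γ A → Prop
  -- Intuitionistic reductions
  | beta {Γ : List Ty} {A B : Ty} (t : CL (A :: Γ) B) (u : CL Γ A) :
      Red (app (lam t) u) (t.subst (Sub.single u))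
  | fst_pair {Γ : List Ty} {A B : Ty} (t : CL Γ A) (u : CL Γ B) : Red (fst (pair t u)) t
  | snd_pair {Γ : List Ty} {A B : Ty} (t : CL Γ A) (u : CL Γ B) : Red (snd (pair t u)) u
  | ite_tt {Γ : List Ty} {A : Ty} (t u : CL Γ A) : Red (ite tt t u) t
  | ite_ff {Γ : List Ty} {A : Ty} (t u : CL Γ A) : Red (ite ff t u) u
  -- Permutations of the parallel operators with the other constructors
  | app_em {Γ : List Ty} {A B C : Ty} (w : CL Γ (Ty.arr A B))
      (u : CL (Ty.neg C :: Γ) A) (v : CL (C :: Γ) A) :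
      Red (app w (em u v)) (em (app (w.wk _) u) (app (w.wk _) v))
  | em_app {Γ : List Ty} {A B C : Ty} (u : CL (Ty.neg C :: Γ) (Ty.arr A B))
      (v : CL (C :: Γ) (Ty.arr A B)) (w : CL Γ A) :
      Red (app (em u v) w) (em (app u (w.wk _)) (app v (w.wk _)))
  | em_fst {Γ : List Ty} {A B C : Ty} (u : CL (Ty.neg C :: Γ) (Ty.and A B))
      (v : CL (C :: Γ) (Ty.and A B)) : Red (fst (em u v)) (em (fst u) (fst v))
  | em_snd {Γ : List Ty} {A B C : Ty} (u : CL (Ty.neg C :: Γ) (Ty.and A B))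
      (v : CL (C :: Γ) (Ty.and A B)) : Red (snd (em u v)) (em (snd u) (snd v))
  | em_efq {Γ : List Ty} {C : Ty} (P : Ty) (hP : P.IsAtomic) (u : CL (Ty.neg C :: Γ) Ty.bot)
      (v : CL (C :: Γ) Ty.bot) : Red (efq P hP (em u v)) (em (efq P hP u) (efq P hP v))
  | app_par {Γ : List Ty} {A B : Ty} (w : CL Γ (Ty.arr A B)) (u v : CL Γ A) :
      Red (app w (par u v)) (par (app w u) (app w v))
  | par_app {Γ : List Ty} {A B : Ty} (u v : CL Γ (Ty.arr A B)) (w : CL Γ A) :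
      Red (app (par u v) w) (par (app u w) (app v w))
  | par_fst {Γ : List Ty} {A B : Ty} (u v : CL Γ (Ty.and A B)) :
      Red (fst (par u v)) (par (fst u) (fst v))
  | par_snd {Γ : List Ty} {A B : Ty} (u v : CL Γ (Ty.and A B)) :
      Red (snd (par u v)) (par (snd u) (snd v))
  | par_efq {Γ : List Ty} (P : Ty) (hP : P.IsAtomic) (u v : CL Γ Ty.bot) :
      Red (efq P hP (par u v)) (par (efq P hP u) (efq P hP v))
  | lam_em {Γ : List Ty} {A B C : Ty} (u : CL (Ty.neg C :: A :: Γ) B) (v : CL (C :: A :: Γ) B) :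
      Red (lam (em u v)) (em (lam (u.rename Ren.swap)) (lam (v.rename Ren.swap)))
  | lam_par {Γ : List Ty} {A B : Ty} (u v : CL (A :: Γ) B) :
      Red (lam (par u v)) (par (lam u) (lam v))
  | em_pair {Γ : List Ty} {A B C : Ty} (u : CL (Ty.neg C :: Γ) A) (v : CL (C :: Γ) A)
      (w : CL Γ B) : Red (pair (em u v) w) (em (pair u (w.wk _)) (pair v (w.wk _)))
  | pair_em {Γ : List Ty} {A B C : Ty} (w : CL Γ A) (u : CL (Ty.neg C :: Γ) B)
      (v : CL (C :: Γ) B) : Red (pair w (em u v)) (em (pair (w.wk _) u) (pair (w.wk _) v))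
  | par_pair {Γ : List Ty} {A B : Ty} (u v : CL Γ A) (w : CL Γ B) :
      Red (pair (par u v) w) (par (pair u w) (pair v w))
  | pair_par {Γ : List Ty} {A B : Ty} (w : CL Γ A) (u v : CL Γ B) :
      Red (pair w (par u v)) (par (pair w u) (pair w v))
  -- Permutations between parallel operators
  | em_em {Γ : List Ty} {A B D : Ty} (u : CL (Ty.neg A :: Ty.neg B :: Γ) D)
      (v : CL (A :: Ty.neg B :: Γ) D) (w : CL (B :: Γ) D) :
      0 < commComplexity (em u v) w →
      Red (em (em u v) w)
        (em (em (u.rename Ren.swap) (w.rename ((Ren.wk _).lift _)))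
          (em (v.rename Ren.swap) (w.rename ((Ren.wk _).lift _))))
  | em_em' {Γ : List Ty} {A B D : Ty} (w : CL (Ty.neg B :: Γ) D)
      (u : CL (Ty.neg A :: B :: Γ) D) (v : CL (A :: B :: Γ) D) :
      0 < commComplexity w (em u v) →
      Red (em w (em u v))
        (em (em (w.rename ((Ren.wk _).lift _)) (u.rename Ren.swap))
          (em (w.rename ((Ren.wk _).lift _)) (v.rename Ren.swap)))
  | par_em {Γ : List Ty} {B D : Ty} (u v : CL (Ty.neg B :: Γ) D) (w : CL (B :: Γ) D) :
      0 < commComplexity (par u v) w → Red (em (par u v) w) (par (em u w) (em v w))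
  | em_par {Γ : List Ty} {B D : Ty} (w : CL (Ty.neg B :: Γ) D) (u v : CL (B :: Γ) D) :
      0 < commComplexity w (par u v) → Red (em w (par u v)) (par (em w u) (em w v))
  -- Basic cross reduction: `C[ā u] ∥_a D ↦ D[u/a]`, where no free variable of `u` is bound by `C`
  -- and `a` does not occur in `u` (so `u` comes from a term over `Γ`)
  | basicCross {Γ Δ : List Ty} {A B : Ty} (C : Ctx Δ Ty.bot (Ty.neg A :: Γ) B) (u : CL Γ A)
      (D : CL (A :: Γ) B) :
      0 < commComplexity
        (C.plug (app (var (C.emb Var.z)) (u.rename fun _ x => C.emb (Var.s x)))) D →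
      Red (em (C.plug (app (var (C.emb Var.z)) (u.rename fun _ x => C.emb (Var.s x)))) D)
        (D.subst (Sub.single u))
  -- Cross reductions
  | crossL {Γ : List Ty} {A B : Ty} (u : CL Γ B) (v : CL (A :: Γ) B) : Red (em (u.wk _) v) u
  | crossR {Γ : List Ty} {A B : Ty} (u : CL (Ty.neg A :: Γ) B) (v : CL Γ B) :
      Red (em u (v.wk _)) v
  -- `(… ∥ C[ā u] ∥ …) ∥_a D ↦ (C[b̄ ⟨y⟩] ∥_a D) ∥_b D[u^{b/y}/a]`. The component `r` is `C[ā u]`;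
  -- `C` is written in the scope enlarged by the fresh channel `b̄`. The message is the image under
  -- `ρ` of a term `u` over `(Y :: Ys) ++ Γ`, where the variables from `Y :: Ys` stand for the
  -- pairwise distinct free variables `y` of the message which are bound by `C`, and those from `Γ`
  -- for its other free variables; in particular neither `a` nor `b` occurs in the message.
  | cross {Γ Δ : List Ty} {A B : Ty} (L : CL (Ty.neg A :: Γ) B) (D : CL (A :: Γ) B)
      (r : CL (Ty.neg A :: Γ) B) (Y : Ty) (Ys : List Ty)
      (C : Ctx Δ Ty.bot (Ty.neg A :: Ty.neg (Ty.conj Y Ys) :: Γ) B)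
      (u : CL ((Y :: Ys) ++ Γ) A) (ρ : Ren ((Y :: Ys) ++ Γ) Δ) :
      L.NormalSimpleParallel →
      r ∈ L.components →
      r.rename ((Ren.wk (Ty.neg (Ty.conj Y Ys))).lift (Ty.neg A))
        = C.plug (app (var (C.emb Var.z)) (u.rename ρ)) →
      (∀ (T : Ty) (x : Var Γ T), ρ (Var.inr (Y :: Ys) x) = C.emb (Var.s (Var.s x))) →
      (∀ (T : Ty) (y : Var (Y :: Ys) T) (x : Var (Ty.neg A :: Ty.neg (Ty.conj Y Ys) :: Γ) T),
        ρ (Var.inl y) ≠ C.emb x) →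
      (∀ (T : Ty) (y y' : Var (Y :: Ys) T), ρ (Var.inl y) = ρ (Var.inl y') → y = y') →
      (∀ (T : Ty) (y : Var (Y :: Ys) T), u.Occ (Var.inl (Δ := Γ) y).idx) →
      C.RightFree 0 →
      0 < commComplexity L D →
      Red (em L D)
        (em
          (em
            (C.plug (app (var (C.emb (Var.s Var.z))) (tuple Y Ys fun _ y => var (ρ (Var.inl y)))))
            (D.rename ((Ren.wk _).lift A)))
          (D.subst (replaceTop (u.subst (multiSub Y Ys)))))

/-- One-step reduction: a basic reduction inside an arbitrary context. -/
inductive Step : {Γ : List Ty} → {A : Ty} → CL Γ A → CL Γ A → Prop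
  | ctx {Δ Γ : List Ty} {H A : Ty} (C : Ctx Δ H Γ A) {t t' : CL Δ H} :
      Red t t' → Step (C.plug t) (C.plug t')

/-- Many-step reduction. -/
def Steps {Γ : List Ty} {A : Ty} : CL Γ A → CL Γ A → Prop := Relation.ReflTransGen Step

/-- `O` is a parallel OR: `O F F ↦* F`, and `O u T ↦* T`, `O T u ↦* T` for every term `u`,
where `u` may have arbitrary further free variables. -/
def IsParallelOr {Γ : List Ty} (O : CL Γ (Ty.arr Ty.bool (Ty.arr Ty.bool Ty.bool))) : Prop :=
  Steps (app (app O ff) ff) ff ∧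
  ∀ (Δ : List Ty) (ρ : Ren Γ Δ) (u : CL Δ Ty.bool),
    Steps (app (app (O.rename ρ) u) tt) tt ∧ Steps (app (app (O.rename ρ) tt) u) tt

end CL

/-! ## The propositional lambda-mu-calculus with Booleans -/

/-- `Mu Γ Δ A`: lambda-mu-terms of type `A` with lambda-variables in `Γ` and mu-variables in `Δ`
(a mu-variable listed with type `A` stands for an assumption `¬ A`). `named α t` is `[α] t` and
`mu t` is `μ α. t`. Ex falso is `μ α. t` with `α` not occurring in `t`. -/
inductive Mu : List Ty → List Ty → Ty → Type
  | var {Γ Δ : List Ty} {A : Ty} : Var Γ A → Mu Γ Δ A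
  | lam {Γ Δ : List Ty} {A B : Ty} : Mu (A :: Γ) Δ B → Mu Γ Δ (Ty.arr A B)
  | app {Γ Δ : List Ty} {A B : Ty} : Mu Γ Δ (Ty.arr A B) → Mu Γ Δ A → Mu Γ Δ B
  | pair {Γ Δ : List Ty} {A B : Ty} : Mu Γ Δ A → Mu Γ Δ B → Mu Γ Δ (Ty.and A B)
  | fst {Γ Δ : List Ty} {A B : Ty} : Mu Γ Δ (Ty.and A B) → Mu Γ Δ A
  | snd {Γ Δ : List Ty} {A B : Ty} : Mu Γ Δ (Ty.and A B) → Mu Γ Δ B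
  | tt {Γ Δ : List Ty} : Mu Γ Δ Ty.bool
  | ff {Γ Δ : List Ty} : Mu Γ Δ Ty.bool
  | ite {Γ Δ : List Ty} {A : Ty} : Mu Γ Δ Ty.bool → Mu Γ Δ A → Mu Γ Δ A → Mu Γ Δ A
  | named {Γ Δ : List Ty} {A : Ty} : Var Δ A → Mu Γ Δ A → Mu Γ Δ Ty.bot
  | mu {Γ Δ : List Ty} {A : Ty} : Mu Γ (A :: Δ) Ty.bot → Mu Γ Δ A

namespace Mu

def rename {Γ Δ : List Ty} {A : Ty} :
    Mu Γ Δ A → {Γ' Δ' : List Ty} → Ren Γ Γ' → Ren Δ Δ' → Mu Γ' Δ' A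
  | var x, _, _, ρ, _ => var (ρ x)
  | lam t, _, _, ρ, θ => lam (t.rename (ρ.lift _) θ)
  | app t u, _, _, ρ, θ => app (t.rename ρ θ) (u.rename ρ θ)
  | pair t u, _, _, ρ, θ => pair (t.rename ρ θ) (u.rename ρ θ)
  | fst t, _, _, ρ, θ => fst (t.rename ρ θ)
  | snd t, _, _, ρ, θ => snd (t.rename ρ θ)
  | tt, _, _, _, _ => tt
  | ff, _, _, _, _ => ff
  | ite c t u, _, _, ρ, θ => ite (c.rename ρ θ) (t.rename ρ θ) (u.rename ρ θ)
  | named α t, _, _, ρ, θ => named (θ α) (t.rename ρ θ)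
  | mu t, _, _, ρ, θ => mu (t.rename ρ (θ.lift _))

/-- Weakening by one lambda-variable. -/
def wkVar {Γ Δ : List Ty} {A : Ty} (C : Ty) (t : Mu Γ Δ A) : Mu (C :: Γ) Δ A :=
  t.rename (Ren.wk C) (fun _ α => α)

/-- Weakening by one mu-variable. -/
def wkName {Γ Δ : List Ty} {A : Ty} (C : Ty) (t : Mu Γ Δ A) : Mu Γ (C :: Δ) A :=
  t.rename (fun _ x => x) (Ren.wk C)

/-- Simultaneous substitutions of lambda-variables. -/
abbrev Sub (Γ Γ' Δ : List Ty) : Type := ∀ ⦃A : Ty⦄, Var Γ A → Mu Γ' Δ A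

def Sub.lift {Γ Γ' Δ : List Ty} (σ : Sub Γ Γ' Δ) (C : Ty) : Sub (C :: Γ) (C :: Γ') Δ
  | _, Var.z => var Var.z
  | _, Var.s x => (σ x).wkVar C

def subst {Γ Δ : List Ty} {A : Ty} : Mu Γ Δ A → {Γ' : List Ty} → Sub Γ Γ' Δ → Mu Γ' Δ A
  | var x, _, σ => σ x
  | lam t, _, σ => lam (t.subst (Sub.lift σ _))
  | app t u, _, σ => app (t.subst σ) (u.subst σ)
  | pair t u, _, σ => pair (t.subst σ) (u.subst σ)
  | fst t, _, σ => fst (t.subst σ)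
  | snd t, _, σ => snd (t.subst σ)
  | tt, _, _ => tt
  | ff, _, _ => ff
  | ite c t u, _, σ => ite (c.subst σ) (t.subst σ) (u.subst σ)
  | named α t, _, σ => named α (t.subst σ)
  | mu t, _, σ => mu (t.subst fun _ x => (σ x).wkName _)

/-- The substitution replacing the innermost lambda-variable by `u`. -/
def Sub.single {Γ Δ : List Ty} {C : Ty} (u : Mu Γ Δ C) : Sub (C :: Γ) Γ Δ
  | _, Var.z => u
  | _, Var.s x => var x

/-- Elementary elimination contexts, from type `A` to type `B`. -/
inductive Frame (Γ Δ : List Ty) : Ty → Ty → Type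
  | app {A B : Ty} : Mu Γ Δ A → Frame Γ Δ (Ty.arr A B) B
  | fst {A B : Ty} : Frame Γ Δ (Ty.and A B) A
  | snd {A B : Ty} : Frame Γ Δ (Ty.and A B) B
  | ite {A : Ty} : Mu Γ Δ A → Mu Γ Δ A → Frame Γ Δ Ty.bool A

namespace Frame

def plug {Γ Δ : List Ty} {A B : Ty} : Frame Γ Δ A B → Mu Γ Δ A → Mu Γ Δ B
  | app u, t => Mu.app t u
  | fst, t => Mu.fst t
  | snd, t => Mu.snd t
  | ite u v, t => Mu.ite t u v

def rename {Γ Δ : List Ty} {A B : Ty} :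
    Frame Γ Δ A B → {Γ' Δ' : List Ty} → Ren Γ Γ' → Ren Δ Δ' → Frame Γ' Δ' A B
  | app u, _, _, ρ, θ => app (u.rename ρ θ)
  | fst, _, _, _, _ => fst
  | snd, _, _, _, _ => snd
  | ite u v, _, _, ρ, θ => ite (u.rename ρ θ) (v.rename ρ θ)

end Frame

/-- What a mu-variable of type `A` is replaced by in a structural substitution: `name β` replaces
`[α] t` by `[β] t`, and `push F β` replaces `[α] t` by `[β] F[t]`. -/
inductive Co (Γ Δ : List Ty) : Ty → Type
  | name {A : Ty} : Var Δ A → Co Γ Δ A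
  | push {A B : Ty} : Frame Γ Δ A B → Var Δ B → Co Γ Δ A

namespace Co

def rename {Γ Δ : List Ty} {A : Ty} :
    Co Γ Δ A → {Γ' Δ' : List Ty} → Ren Γ Γ' → Ren Δ Δ' → Co Γ' Δ' A
  | name β, _, _, _, θ => name (θ β)
  | push F β, _, _, ρ, θ => push (F.rename ρ θ) (θ β)

def apply {Γ Δ : List Ty} {A : Ty} : Co Γ Δ A → Mu Γ Δ A → Mu Γ Δ Ty.bot
  | name β, t => named β t
  | push F β, t => named β (F.plug t)

end Co

/-- Simultaneous structural substitutions. -/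
abbrev CoSub (Γ Δ Δ' : List Ty) : Type := ∀ ⦃A : Ty⦄, Var Δ A → Co Γ Δ' A

def CoSub.liftVar {Γ Δ Δ' : List Ty} (κ : CoSub Γ Δ Δ') (C : Ty) : CoSub (C :: Γ) Δ Δ' :=
  fun _ α => (κ α).rename (Ren.wk C) (fun _ β => β)

def CoSub.liftName {Γ Δ Δ' : List Ty} (κ : CoSub Γ Δ Δ') (C : Ty) : CoSub Γ (C :: Δ) (C :: Δ')
  | _, Var.z => Co.name Var.z
  | _, Var.s α => (κ α).rename (fun _ x => x) (Ren.wk C)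

/-- Structural substitution. -/
def cosubst {Γ Δ : List Ty} {A : Ty} : Mu Γ Δ A → {Δ' : List Ty} → CoSub Γ Δ Δ' → Mu Γ Δ' A
  | var x, _, _ => var x
  | lam t, _, κ => lam (t.cosubst (CoSub.liftVar κ _))
  | app t u, _, κ => app (t.cosubst κ) (u.cosubst κ)
  | pair t u, _, κ => pair (t.cosubst κ) (u.cosubst κ)
  | fst t, _, κ => fst (t.cosubst κ)
  | snd t, _, κ => snd (t.cosubst κ)
  | tt, _, _ => tt
  | ff, _, _ => ff
  | ite c t u, _, κ => ite (c.cosubst κ) (t.cosubst κ) (u.cosubst κ)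
  | named α t, _, κ => (κ α).apply (t.cosubst κ)
  | mu t, _, κ => mu (t.cosubst (CoSub.liftName κ _))

/-- The structural substitution replacing `[α] t` by `[α] F[t]` for the innermost mu-variable. -/
def Frame.toCoSub {Γ Δ : List Ty} {A B : Ty} (F : Frame Γ Δ A B) : CoSub Γ (A :: Δ) (B :: Δ)
  | _, Var.z => Co.push (F.rename (fun _ x => x) (Ren.wk B)) Var.z
  | _, Var.s α => Co.name (Var.s α)

/-- One-step reduction, in arbitrary position. -/
inductive Step : {Γ Δ : List Ty} → {A : Ty} → Mu Γ Δ A → Mu Γ Δ A → Prop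
  | beta {Γ Δ : List Ty} {A B : Ty} (t : Mu (A :: Γ) Δ B) (u : Mu Γ Δ A) :
      Step (app (lam t) u) (t.subst (Sub.single u))
  | fst_pair {Γ Δ : List Ty} {A B : Ty} (t : Mu Γ Δ A) (u : Mu Γ Δ B) : Step (fst (pair t u)) t
  | snd_pair {Γ Δ : List Ty} {A B : Ty} (t : Mu Γ Δ A) (u : Mu Γ Δ B) : Step (snd (pair t u)) u
  | ite_tt {Γ Δ : List Ty} {A : Ty} (t u : Mu Γ Δ A) : Step (ite tt t u) t
  | ite_ff {Γ Δ : List Ty} {A : Ty} (t u : Mu Γ Δ A) : Step (ite ff t u) u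
  -- structural reduction: `F[μ α. t] ↦ μ α. t[[α] F[·] / [α] ·]`
  | struct {Γ Δ : List Ty} {A B : Ty} (F : Frame Γ Δ A B) (t : Mu Γ (A :: Δ) Ty.bot) :
      Step (F.plug (mu t)) (mu (t.cosubst F.toCoSub))
  -- renaming: `[β] μ α. t ↦ t[β/α]`
  | renaming {Γ Δ : List Ty} {A : Ty} (β : Var Δ A) (t : Mu Γ (A :: Δ) Ty.bot) :
      Step (named β (mu t)) (t.rename (fun _ x => x) (Ren.inst β))
  -- `μ α. [α] t ↦ t` if `α` does not occur in `t`
  | mu_eta {Γ Δ : List Ty} {A : Ty} (t : Mu Γ Δ A) : Step (mu (named Var.z (t.wkName A))) t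
  | lam {Γ Δ : List Ty} {A B : Ty} {t t' : Mu (A :: Γ) Δ B} : Step t t' → Step (lam t) (lam t')
  | appL {Γ Δ : List Ty} {A B : Ty} {t t' : Mu Γ Δ (Ty.arr A B)} {u : Mu Γ Δ A} :
      Step t t' → Step (app t u) (app t' u)
  | appR {Γ Δ : List Ty} {A B : Ty} {t : Mu Γ Δ (Ty.arr A B)} {u u' : Mu Γ Δ A} :
      Step u u' → Step (app t u) (app t u')
  | pairL {Γ Δ : List Ty} {A B : Ty} {t t' : Mu Γ Δ A} {u : Mu Γ Δ B} :
      Step t t' → Step (pair t u) (pair t' u)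
  | pairR {Γ Δ : List Ty} {A B : Ty} {t : Mu Γ Δ A} {u u' : Mu Γ Δ B} :
      Step u u' → Step (pair t u) (pair t u')
  | fst {Γ Δ : List Ty} {A B : Ty} {t t' : Mu Γ Δ (Ty.and A B)} :
      Step t t' → Step (fst t) (fst t')
  | snd {Γ Δ : List Ty} {A B : Ty} {t t' : Mu Γ Δ (Ty.and A B)} :
      Step t t' → Step (snd t) (snd t')
  | iteC {Γ Δ : List Ty} {A : Ty} {c c' : Mu Γ Δ Ty.bool} {t u : Mu Γ Δ A} :
      Step c c' → Step (ite c t u) (ite c' t u)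
  | iteT {Γ Δ : List Ty} {A : Ty} {c : Mu Γ Δ Ty.bool} {t t' u : Mu Γ Δ A} :
      Step t t' → Step (ite c t u) (ite c t' u)
  | iteE {Γ Δ : List Ty} {A : Ty} {c : Mu Γ Δ Ty.bool} {t u u' : Mu Γ Δ A} :
      Step u u' → Step (ite c t u) (ite c t u')
  | named {Γ Δ : List Ty} {A : Ty} {α : Var Δ A} {t t' : Mu Γ Δ A} :
      Step t t' → Step (named α t) (named α t')
  | mu {Γ Δ : List Ty} {A : Ty} {t t' : Mu Γ (A :: Δ) Ty.bot} : Step t t' → Step (mu t) (mu t')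

/-- Many-step reduction. -/
def Steps {Γ Δ : List Ty} {A : Ty} : Mu Γ Δ A → Mu Γ Δ A → Prop := Relation.ReflTransGen Step

/-- `O` is a parallel OR: `O F F ↦* F`, and `O u T ↦* T`, `O T u ↦* T` for every term `u`,
where `u` may have arbitrary further free variables. -/
def IsParallelOr {Γ Δ : List Ty} (O : Mu Γ Δ (Ty.arr Ty.bool (Ty.arr Ty.bool Ty.bool))) : Prop :=
  Steps (app (app O ff) ff) ff ∧
  ∀ (Γ' Δ' : List Ty) (ρ : Ren Γ Γ') (θ : Ren Δ Δ') (u : Mu Γ' Δ' Ty.bool),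
    Steps (app (app (O.rename ρ θ) u) tt) tt ∧ Steps (app (app (O.rename ρ θ) tt) u) tt

end Mu

/-! ## Embedding the lambda-mu-calculus into the simply typed lambda-calculus -/

/-- The type translation: atoms `p` become `¬ p`, the Boolean type becomes `¬ ¬ Bool`, and
implication, conjunction and falsum are preserved. -/
def Ty.stable : Ty → Ty
  | Ty.atom n => Ty.neg (Ty.atom n)
  | Ty.bot => Ty.bot
  | Ty.bool => Ty.neg (Ty.neg Ty.bool)
  | Ty.arr A B => Ty.arr A.stable B.stable
  | Ty.and A B => Ty.and A.stable B.stable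

/-- The truth value `b` at type `¬ ¬ Bool`: `λ k. k b`. -/
def Lam.ret {Γ : List Ty} (b : Lam (Ty.neg Ty.bool :: Γ) Ty.bool) :
    Lam Γ (Ty.neg (Ty.neg Ty.bool)) :=
  Lam.lam (Lam.app (Lam.var Var.z) b)

/-- `e` is an embedding of the lambda-mu-calculus (terms without free mu-variables) into the simply
typed lambda-calculus: it commutes with variables, abstraction, application, pairing and
projections, sends truth values to truth values, and turns reduction into convertibility. -/
def IsMuEmbedding
    (e : ∀ (Γ : List Ty) (A : Ty), Mu Γ [] A → Lam (Γ.map Ty.stable) A.stable) : Prop :=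
  (∀ (Γ : List Ty) (A : Ty) (x : Var Γ A), e Γ A (Mu.var x) = Lam.var (x.mapTy Ty.stable)) ∧
  (∀ (Γ : List Ty) (A B : Ty) (t : Mu (A :: Γ) [] B),
    e Γ (Ty.arr A B) (Mu.lam t) = Lam.lam (e (A :: Γ) B t)) ∧
  (∀ (Γ : List Ty) (A B : Ty) (t : Mu Γ [] (Ty.arr A B)) (u : Mu Γ [] A),
    e Γ B (Mu.app t u) = Lam.app (e Γ (Ty.arr A B) t) (e Γ A u)) ∧
  (∀ (Γ : List Ty) (A B : Ty) (t : Mu Γ [] A) (u : Mu Γ [] B),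
    e Γ (Ty.and A B) (Mu.pair t u) = Lam.pair (e Γ A t) (e Γ B u)) ∧
  (∀ (Γ : List Ty) (A B : Ty) (t : Mu Γ [] (Ty.and A B)),
    e Γ A (Mu.fst t) = Lam.fst (e Γ (Ty.and A B) t)) ∧
  (∀ (Γ : List Ty) (A B : Ty) (t : Mu Γ [] (Ty.and A B)),
    e Γ B (Mu.snd t) = Lam.snd (e Γ (Ty.and A B) t)) ∧
  (∀ Γ : List Ty, e Γ Ty.bool Mu.tt = Lam.ret Lam.tt) ∧
  (∀ Γ : List Ty, e Γ Ty.bool Mu.ff = Lam.ret Lam.ff) ∧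
  (∀ (Γ : List Ty) (A : Ty) (t u : Mu Γ [] A), Mu.Step t u → Lam.Conv (e Γ A t) (e Γ A u))

end ParCalc

open ParCalc

/-!
The parallel calculus contains the simply typed lambda-calculus because none of its additional
rules applies to a term without parallel operators (`Lam.toCL_step_iff`).

The lambda-mu-calculus is translated by giving to every mu-variable of type `A` a *stack*: an
elimination context from `A.stable` to falsum, ending with an argument of atomic type, with a
continuation for truth values, or at falsum itself. The term `[α] t` puts `t` into the stack of
`α`, and `μ α. t` abstracts over the stack, which is possible at every translated type since a
stack is determined by finitely many arguments and projections (`StackFun.abs`). Interpreting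
mu-variables by plain variables of type `¬ A.stable` would not validate the rule `[β] μ α. t ↦
t[β/α]`. Abstraction over stacks satisfies a beta rule (`StackFun.plug_abs`) and, by
extensionality, an eta rule (`StackFun.abs_ofTerm`), so that two translated terms are convertible
as soon as they agree in all stacks; the structural rules of the lambda-mu-calculus then hold
because both sides compute the same thing in every stack (`Mu.Step.trans_conv`).

Parallel OR is definable in the parallel calculus by racing two conditionals, one on each argument;
if both arguments are false, one side communicates this to the other (`CL.isParallelOr_parallelOr`).

For the other two calculi, terms are interpreted in the full type hierarchy over the truth values
with an undefined element `⊥`. All terms preserve the ternary relation "one of the first two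
components is `⊥`, or all three are equal" (`Lam.rel_den`). A parallel OR, given a fresh
variable as its undefined argument, maps the related triples `(⊥, T, F)` and `(T, ⊥, F)`
to `(T, T, F)`, which is not related. In the case of the lambda-mu-calculus, this is applied to the
translated term at the identity continuation on the interpretation of falsum.
-/

namespace ParCalc

/-! ### Substitution in the simply typed lambda-calculus -/

/-- Extension of a family indexed by the variables of `Γ` by a value for one more variable. -/
def Var.cons {P : Ty → Type} {Γ : List Ty} {C : Ty} (p : P C) (f : ∀ ⦃A : Ty⦄, Var Γ A → P A) :
    ∀ ⦃A : Ty⦄, Var (C :: Γ) A → P A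
  | _, Var.z => p
  | _, Var.s x => f x

namespace Lam

theorem rename_rename {Γ : List Ty} {A : Ty} (t : Lam Γ A) :
    ∀ {Δ Θ : List Ty} (ρ : Ren Γ Δ) (θ : Ren Δ Θ),
      (t.rename ρ).rename θ = t.rename fun _ x => θ (ρ x) := by
  induction t with
  | lam t ih =>
    intro Δ Θ ρ θ
    simp only [rename, ih]
    congr 2; funext B x; cases x <;> rfl
  | _ => intros; simp_all only [rename]

theorem subst_rename {Γ : List Ty} {A : Ty} (t : Lam Γ A) :
    ∀ {Δ Θ : List Ty} (ρ : Ren Γ Δ) (τ : Sub Δ Θ),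
      (t.rename ρ).subst τ = t.subst fun _ x => τ (ρ x) := by
  induction t with
  | lam t ih =>
    intro Δ Θ ρ τ
    simp only [rename, subst, ih]
    congr 2; funext B x; cases x <;> rfl
  | _ => intros; simp_all only [rename, subst]

theorem rename_subst {Γ : List Ty} {A : Ty} (t : Lam Γ A) :
    ∀ {Δ Θ : List Ty} (σ : Sub Γ Δ) (θ : Ren Δ Θ),
      (t.subst σ).rename θ = t.subst fun _ x => (σ x).rename θ := by
  induction t with
  | lam t ih =>
    intro Δ Θ σ θ
    simp only [rename, subst, ih]
    congr 2; funext B x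
    cases x with
    | z => rfl
    | s x => simp only [Sub.lift, rename_rename]; rfl
  | _ => intros; simp_all only [rename, subst]

theorem subst_subst {Γ : List Ty} {A : Ty} (t : Lam Γ A) :
    ∀ {Δ Θ : List Ty} (σ : Sub Γ Δ) (τ : Sub Δ Θ),
      (t.subst σ).subst τ = t.subst fun _ x => (σ x).subst τ := by
  induction t with
  | lam t ih =>
    intro Δ Θ σ τ
    simp only [subst, ih]
    congr 2; funext B x
    cases x with
    | z => rfl
    | s x => simp only [Sub.lift, rename_subst, subst_rename]; rfl
  | _ => intros; simp_all only [subst]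

theorem subst_var {Γ : List Ty} {A : Ty} (t : Lam Γ A) : t.subst (fun _ x => var x) = t := by
  induction t with
  | @lam Γ A B t ih =>
    have h : Sub.lift (fun _ x => var x : Sub Γ Γ) A = fun _ x => var x := by
      funext C x; cases x <;> rfl
    simp only [subst, h, ih]
  | _ => simp_all only [subst]

theorem rename_eq_subst {Γ Δ : List Ty} {A : Ty} (t : Lam Γ A) (ρ : Ren Γ Δ) :
    t.rename ρ = t.subst fun _ x => var (ρ x) := by
  rw [← subst_var (t.rename ρ), subst_rename]

end Lam

/-! ### Simply typed terms inside the parallel calculus -/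

namespace CL

/-- The simply typed term underlying a term without parallel operators. -/
def toLam? {Γ : List Ty} {A : Ty} : CL Γ A → Option (Lam Γ A)
  | var x => some (Lam.var x)
  | lam t => t.toLam?.map Lam.lam
  | app t u => t.toLam?.bind fun t' => u.toLam?.map (Lam.app t')
  | pair t u => t.toLam?.bind fun t' => u.toLam?.map (Lam.pair t')
  | fst t => t.toLam?.map Lam.fst
  | snd t => t.toLam?.map Lam.snd
  | efq P hP t => t.toLam?.map (Lam.efq P hP)
  | tt => some Lam.tt
  | ff => some Lam.ff
  | ite c t u =>
    c.toLam?.bind fun c' => t.toLam?.bind fun t' => u.toLam?.map (Lam.ite c' t')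
  | par _ _ => none
  | em _ _ => none

theorem toLam?_toCL {Γ : List Ty} {A : Ty} (t : Lam Γ A) : t.toCL.toLam? = some t := by
  induction t <;> simp_all [Lam.toCL, toLam?]

/-- The context `C[D[ ]]`. -/
def Ctx.comp {Δ Θ : List Ty} {H B : Ty} : {Γ : List Ty} → {A : Ty} →
    Ctx Θ B Γ A → Ctx Δ H Θ B → Ctx Δ H Γ A
  | _, _, hole, D => D
  | _, _, lam C, D => lam (C.comp D)
  | _, _, appL C u, D => appL (C.comp D) u
  | _, _, appR u C, D => appR u (C.comp D)
  | _, _, pairL C u, D => pairL (C.comp D) u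
  | _, _, pairR u C, D => pairR u (C.comp D)
  | _, _, fst C, D => fst (C.comp D)
  | _, _, snd C, D => snd (C.comp D)
  | _, _, efq P hP C, D => efq P hP (C.comp D)
  | _, _, iteC C u v, D => iteC (C.comp D) u v
  | _, _, iteT c C v, D => iteT c (C.comp D) v
  | _, _, iteE c u C, D => iteE c u (C.comp D)
  | _, _, parL C u, D => parL (C.comp D) u
  | _, _, parR u C, D => parR u (C.comp D)
  | _, _, emL C u, D => emL (C.comp D) u
  | _, _, emR u C, D => emR u (C.comp D)

theorem Ctx.comp_plug {Δ Θ Γ : List Ty} {H B A : Ty} (C : Ctx Θ B Γ A) (D : Ctx Δ H Θ B)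
    (t : CL Δ H) : (C.comp D).plug t = C.plug (D.plug t) := by
  induction C <;> simp_all [comp, plug]

theorem Step.plug {Γ Θ : List Ty} {A B : Ty} {t u : CL Θ B} (h : Step t u) (C : Ctx Θ B Γ A) :
    Step (C.plug t) (C.plug u) := by
  obtain ⟨D, hr⟩ := h
  rw [← Ctx.comp_plug, ← Ctx.comp_plug]
  exact .ctx _ hr

end CL

namespace Lam

theorem toCL_injective {Γ : List Ty} {A : Ty} :
    Function.Injective (toCL : Lam Γ A → CL Γ A) := fun t u h =>
  Option.some.inj (by rw [← CL.toLam?_toCL t, ← CL.toLam?_toCL u, h])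

theorem toCL_rename {Γ : List Ty} {A : Ty} (t : Lam Γ A) :
    ∀ {Δ : List Ty} (ρ : Ren Γ Δ), (t.rename ρ).toCL = t.toCL.rename ρ := by
  induction t <;> intros <;> simp_all only [rename, toCL, CL.rename]

theorem toCL_subst {Γ : List Ty} {A : Ty} (t : Lam Γ A) :
    ∀ {Δ : List Ty} (σ : Sub Γ Δ), (t.subst σ).toCL = t.toCL.subst fun _ x => (σ x).toCL := by
  induction t with
  | lam t ih =>
    intro Δ σ
    simp only [subst, toCL, CL.subst, ih]
    congr 2; funext B x
    cases x with
    | z => rfl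
    | s x => simp only [Sub.lift, toCL_rename]; rfl
  | _ => intros; simp_all only [subst, toCL, CL.subst]

section inversion

variable {Γ : List Ty} {A B : Ty}

theorem toCL_eq_lam {s : Lam Γ (Ty.arr A B)} {t : CL (A :: Γ) B} (h : s.toCL = CL.lam t) :
    ∃ t', s = lam t' ∧ t'.toCL = t := by
  cases s <;> simp_all [toCL]

theorem toCL_eq_app {s : Lam Γ B} {t : CL Γ (Ty.arr A B)} {u : CL Γ A}
    (h : s.toCL = CL.app t u) : ∃ t' u', s = app t' u' ∧ t'.toCL = t ∧ u'.toCL = u := by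
  cases s <;> simp only [toCL, reduceCtorEq] at h
  case app u' t' =>
    injection h with _ h₁ _ h₂ h₃
    subst h₁
    exact ⟨t', u', rfl, eq_of_heq h₂, eq_of_heq h₃⟩

theorem toCL_eq_pair {s : Lam Γ (Ty.and A B)} {t : CL Γ A} {u : CL Γ B}
    (h : s.toCL = CL.pair t u) : ∃ t' u', s = pair t' u' ∧ t'.toCL = t ∧ u'.toCL = u := by
  cases s <;> simp_all [toCL]

theorem toCL_eq_fst {s : Lam Γ A} {t : CL Γ (Ty.and A B)} (h : s.toCL = CL.fst t) :
    ∃ t', s = fst t' ∧ t'.toCL = t := by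
  cases s <;> simp only [toCL, reduceCtorEq] at h
  case fst t' =>
    injection h with _ _ h₁ h₂
    subst h₁
    exact ⟨t', rfl, eq_of_heq h₂⟩

theorem toCL_eq_snd {s : Lam Γ B} {t : CL Γ (Ty.and A B)} (h : s.toCL = CL.snd t) :
    ∃ t', s = snd t' ∧ t'.toCL = t := by
  cases s <;> simp only [toCL, reduceCtorEq] at h
  case snd t' =>
    injection h with _ h₁ _ h₂
    subst h₁
    exact ⟨t', rfl, eq_of_heq h₂⟩

theorem toCL_eq_efq {P : Ty} {hP : P.IsAtomic} {s : Lam Γ P} {t : CL Γ Ty.bot}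
    (h : s.toCL = CL.efq P hP t) : ∃ t', s = efq P hP t' ∧ t'.toCL = t := by
  cases s <;> simp_all [toCL]

theorem toCL_eq_ite {s : Lam Γ A} {c : CL Γ Ty.bool} {t u : CL Γ A}
    (h : s.toCL = CL.ite c t u) :
    ∃ c' t' u', s = ite c' t' u' ∧ c'.toCL = c ∧ t'.toCL = t ∧ u'.toCL = u := by
  cases s <;> simp_all [toCL]

theorem toCL_eq_tt {s : Lam Γ Ty.bool} (h : s.toCL = CL.tt) : s = tt := toCL_injective h

theorem toCL_eq_ff {s : Lam Γ Ty.bool} (h : s.toCL = CL.ff) : s = ff := toCL_injective h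

theorem toCL_ne_par (s : Lam Γ A) (t u : CL Γ A) : s.toCL ≠ CL.par t u := by
  cases s <;> simp [toCL]

theorem toCL_ne_em (s : Lam Γ A) (t : CL (Ty.neg B :: Γ) A) (u : CL (B :: Γ) A) :
    s.toCL ≠ CL.em t u := by
  cases s <;> simp [toCL]

end inversion

/-- Only the intuitionistic rules have a left-hand side that can be simply typed. -/
theorem exists_step_of_red {Γ : List Ty} {A : Ty} {a b : CL Γ A} (h : CL.Red a b) :
    ∀ s : Lam Γ A, s.toCL = a → ∃ u, Step s u ∧ u.toCL = b := by
  intro s hs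
  cases h with
  | beta t u =>
    obtain ⟨f, u, rfl, hf, rfl⟩ := toCL_eq_app hs
    obtain ⟨t, rfl, rfl⟩ := toCL_eq_lam hf
    refine ⟨_, Step.beta t u, ?_⟩
    rw [toCL_subst]
    congr 1; funext B x; cases x <;> rfl
  | fst_pair t u =>
    obtain ⟨p, rfl, hp⟩ := toCL_eq_fst hs
    obtain ⟨t, u, rfl, rfl, rfl⟩ := toCL_eq_pair hp
    exact ⟨t, Step.fst_pair t u, rfl⟩
  | snd_pair t u =>
    obtain ⟨p, rfl, hp⟩ := toCL_eq_snd hs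
    obtain ⟨t, u, rfl, rfl, rfl⟩ := toCL_eq_pair hp
    exact ⟨u, Step.snd_pair t u, rfl⟩
  | ite_tt t u =>
    obtain ⟨c, t, u, rfl, hc, rfl, rfl⟩ := toCL_eq_ite hs
    obtain rfl := toCL_eq_tt hc
    exact ⟨t, Step.ite_tt t u, rfl⟩
  | ite_ff t u =>
    obtain ⟨c, t, u, rfl, hc, rfl, rfl⟩ := toCL_eq_ite hs
    obtain rfl := toCL_eq_ff hc
    exact ⟨u, Step.ite_ff t u, rfl⟩
  | app_em | app_par =>
    obtain ⟨_, _, rfl, _, h⟩ := toCL_eq_app hs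
    first | exact (toCL_ne_em _ _ _ h).elim | exact (toCL_ne_par _ _ _ h).elim
  | em_app | par_app =>
    obtain ⟨_, _, rfl, h, _⟩ := toCL_eq_app hs
    first | exact (toCL_ne_em _ _ _ h).elim | exact (toCL_ne_par _ _ _ h).elim
  | em_fst | par_fst =>
    obtain ⟨_, rfl, h⟩ := toCL_eq_fst hs
    first | exact (toCL_ne_em _ _ _ h).elim | exact (toCL_ne_par _ _ _ h).elim
  | em_snd | par_snd =>
    obtain ⟨_, rfl, h⟩ := toCL_eq_snd hs
    first | exact (toCL_ne_em _ _ _ h).elim | exact (toCL_ne_par _ _ _ h).elim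
  | em_efq | par_efq =>
    obtain ⟨_, rfl, h⟩ := toCL_eq_efq hs
    first | exact (toCL_ne_em _ _ _ h).elim | exact (toCL_ne_par _ _ _ h).elim
  | lam_em | lam_par =>
    obtain ⟨_, rfl, h⟩ := toCL_eq_lam hs
    first | exact (toCL_ne_em _ _ _ h).elim | exact (toCL_ne_par _ _ _ h).elim
  | em_pair | par_pair =>
    obtain ⟨_, _, rfl, h, _⟩ := toCL_eq_pair hs
    first | exact (toCL_ne_em _ _ _ h).elim | exact (toCL_ne_par _ _ _ h).elim
  | pair_em | pair_par =>
    obtain ⟨_, _, rfl, _, h⟩ := toCL_eq_pair hs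
    first | exact (toCL_ne_em _ _ _ h).elim | exact (toCL_ne_par _ _ _ h).elim
  | _ => exact (toCL_ne_em _ _ _ hs).elim

/-- A context that surrounds a redex in a simply typed term is itself without parallel operators. -/
theorem exists_step_of_plug {Δ Γ : List Ty} {H A : Ty} (C : CL.Ctx Δ H Γ A) {t t' : CL Δ H}
    (h : CL.Red t t') :
    ∀ s : Lam Γ A, s.toCL = C.plug t → ∃ u, Step s u ∧ u.toCL = C.plug t' := by
  induction C with
  | hole => exact exists_step_of_red h
  | lam C ih =>
    intro s hs
    obtain ⟨s, rfl, hs'⟩ := toCL_eq_lam hs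
    obtain ⟨u, hu, hu'⟩ := ih s hs'
    exact ⟨_, hu.lam, congrArg CL.lam hu'⟩
  | appL C w ih =>
    intro s hs
    obtain ⟨s, w, rfl, hs', rfl⟩ := toCL_eq_app hs
    obtain ⟨u, hu, hu'⟩ := ih s hs'
    exact ⟨_, hu.appL, congrArg (CL.app · _) hu'⟩
  | appR w C ih =>
    intro s hs
    obtain ⟨w, s, rfl, rfl, hs'⟩ := toCL_eq_app hs
    obtain ⟨u, hu, hu'⟩ := ih s hs'
    exact ⟨_, hu.appR, congrArg (CL.app _) hu'⟩
  | pairL C w ih =>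
    intro s hs
    obtain ⟨s, w, rfl, hs', rfl⟩ := toCL_eq_pair hs
    obtain ⟨u, hu, hu'⟩ := ih s hs'
    exact ⟨_, hu.pairL, congrArg (CL.pair · _) hu'⟩
  | pairR w C ih =>
    intro s hs
    obtain ⟨w, s, rfl, rfl, hs'⟩ := toCL_eq_pair hs
    obtain ⟨u, hu, hu'⟩ := ih s hs'
    exact ⟨_, hu.pairR, congrArg (CL.pair _) hu'⟩
  | fst C ih =>
    intro s hs
    obtain ⟨s, rfl, hs'⟩ := toCL_eq_fst hs
    obtain ⟨u, hu, hu'⟩ := ih s hs'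
    exact ⟨_, hu.fst, congrArg CL.fst hu'⟩
  | snd C ih =>
    intro s hs
    obtain ⟨s, rfl, hs'⟩ := toCL_eq_snd hs
    obtain ⟨u, hu, hu'⟩ := ih s hs'
    exact ⟨_, hu.snd, congrArg CL.snd hu'⟩
  | efq P hP C ih =>
    intro s hs
    obtain ⟨s, rfl, hs'⟩ := toCL_eq_efq hs
    obtain ⟨u, hu, hu'⟩ := ih s hs'
    exact ⟨_, hu.efq, congrArg (CL.efq P hP) hu'⟩
  | iteC C v w ih =>
    intro s hs
    obtain ⟨s, v, w, rfl, hs', rfl, rfl⟩ := toCL_eq_ite hs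
    obtain ⟨u, hu, hu'⟩ := ih s hs'
    exact ⟨_, hu.iteC, congrArg (CL.ite · _ _) hu'⟩
  | iteT c C w ih =>
    intro s hs
    obtain ⟨c, s, w, rfl, rfl, hs', rfl⟩ := toCL_eq_ite hs
    obtain ⟨u, hu, hu'⟩ := ih s hs'
    exact ⟨_, hu.iteT, congrArg (CL.ite _ · _) hu'⟩
  | iteE c v C ih =>
    intro s hs
    obtain ⟨c, v, s, rfl, rfl, rfl, hs'⟩ := toCL_eq_ite hs
    obtain ⟨u, hu, hu'⟩ := ih s hs'
    exact ⟨_, hu.iteE, congrArg (CL.ite _ _) hu'⟩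
  | parL | parR => exact fun s hs => (toCL_ne_par _ _ _ hs).elim
  | emL | emR => exact fun s hs => (toCL_ne_em _ _ _ hs).elim

theorem Step.toCL {Γ : List Ty} {A : Ty} {t u : Lam Γ A} (h : Step t u) :
    CL.Step t.toCL u.toCL := by
  induction h with
  | beta t u =>
    rw [toCL_subst]
    have e : (fun _ x => (Sub.single u x).toCL : CL.Sub _ _) = CL.Sub.single u.toCL := by
      funext B x; cases x <;> rfl
    rw [e]
    exact .ctx .hole (.beta _ _)
  | fst_pair => exact .ctx .hole (.fst_pair _ _)
  | snd_pair => exact .ctx .hole (.snd_pair _ _)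
  | ite_tt => exact .ctx .hole (.ite_tt _ _)
  | ite_ff => exact .ctx .hole (.ite_ff _ _)
  | lam _ ih => exact ih.plug (.lam .hole)
  | @appL _ _ _ _ _ u _ ih => exact ih.plug (.appL .hole u.toCL)
  | @appR _ _ _ t _ _ _ ih => exact ih.plug (.appR t.toCL .hole)
  | @pairL _ _ _ _ _ u _ ih => exact ih.plug (.pairL .hole u.toCL)
  | @pairR _ _ _ t _ _ _ ih => exact ih.plug (.pairR t.toCL .hole)
  | fst _ ih => exact ih.plug (.fst .hole)
  | snd _ ih => exact ih.plug (.snd .hole)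
  | @efq _ P hP _ _ _ ih => exact ih.plug (.efq P hP .hole)
  | @iteC _ _ _ _ t u _ ih => exact ih.plug (.iteC .hole t.toCL u.toCL)
  | @iteT _ _ c _ _ u _ ih => exact ih.plug (.iteT c.toCL .hole u.toCL)
  | @iteE _ _ c t _ _ _ ih => exact ih.plug (.iteE c.toCL t.toCL .hole)

theorem toCL_step_iff {Γ : List Ty} {A : Ty} (t : Lam Γ A) (r : CL Γ A) :
    CL.Step t.toCL r ↔ ∃ u : Lam Γ A, Step t u ∧ u.toCL = r := by
  constructor
  · intro h
    generalize ha : t.toCL = a at h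
    obtain ⟨C, hr⟩ := h
    exact exists_step_of_plug C hr t ha
  · rintro ⟨u, hu, rfl⟩
    exact hu.toCL

end Lam

/-! ### Stacks -/

namespace Lam

namespace Sub

/-- Composition of substitutions. -/
def comp {Γ Δ Θ : List Ty} (σ : Sub Γ Δ) (τ : Sub Δ Θ) : Sub Γ Θ := fun _ x => (σ x).subst τ

/-- The identity substitution. -/
def id {Γ : List Ty} : Sub Γ Γ := fun _ x => var x

/-- Weakening by one variable. -/
def wk {Γ : List Ty} (C : Ty) : Sub Γ (C :: Γ) := fun _ x => var (Var.s x)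

variable {Γ Δ Θ Ξ : List Ty}

theorem comp_assoc (σ : Sub Γ Δ) (τ : Sub Δ Θ) (υ : Sub Θ Ξ) :
    (σ.comp τ).comp υ = σ.comp (τ.comp υ) := by
  funext A x; exact subst_subst _ _ _

theorem comp_id (σ : Sub Γ Δ) : σ.comp id = σ := by
  funext A x; exact subst_var _

theorem wk_comp_single {C : Ty} (u : Lam Γ C) : (wk C).comp (single u) = id := rfl

theorem wk_comp_lift (σ : Sub Γ Δ) (C : Ty) : (wk C).comp (σ.lift C) = σ.comp (wk C) := by
  funext A x; exact rename_eq_subst _ _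

end Sub

theorem subst_id {Γ : List Ty} {A : Ty} (t : Lam Γ A) : t.subst Sub.id = t := subst_var t

theorem rename_wk {Γ : List Ty} {A : Ty} (C : Ty) (t : Lam Γ A) :
    t.rename (Ren.wk C) = t.subst (Sub.wk C) := rename_eq_subst t _

theorem conv_eta {Γ : List Ty} {A B : Ty} (t : Lam Γ (Ty.arr A B)) :
    Conv (lam (app (t.subst (Sub.wk A)) (var Var.z))) t := rename_wk A t ▸ Conv.eta t

theorem app_var_subst {Γ Δ : List Ty} {A B : Ty} (t : Lam Γ (Ty.arr A B)) (σ : Sub (A :: Γ) Δ) :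
    (app (t.subst (Sub.wk A)) (var Var.z)).subst σ =
      app (t.subst ((Sub.wk A).comp σ)) (σ Var.z) :=
  congrArg (app · _) (subst_subst t _ _)

theorem subst_comp {Γ Δ Θ : List Ty} {A : Ty} (t : Lam Γ A) (σ : Sub Γ Δ) (τ : Sub Δ Θ) :
    (t.subst σ).subst τ = t.subst (σ.comp τ) := subst_subst t σ τ

end Lam

/-- `Stack Γ A`: elimination contexts from the translated type `A.stable` to falsum, with free
variables in `Γ`. They are the values of mu-variables of type `A` under the translation: a term
named by the mu-variable is plugged into the stack. -/
inductive Stack (Γ : List Ty) : Ty → Type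
  | bot : Stack Γ Ty.bot
  | atom {n : ℕ} : Lam Γ (Ty.atom n) → Stack Γ (Ty.atom n)
  | bool : Lam Γ (Ty.neg Ty.bool) → Stack Γ Ty.bool
  | app {A B : Ty} : Lam Γ A.stable → Stack Γ B → Stack Γ (Ty.arr A B)
  | fst {A B : Ty} : Stack Γ A → Stack Γ (Ty.and A B)
  | snd {A B : Ty} : Stack Γ B → Stack Γ (Ty.and A B)

namespace Stack

/-- The result of filling the hole of a stack. -/
def plug {Γ : List Ty} : {A : Ty} → Stack Γ A → Lam Γ A.stable → Lam Γ Ty.bot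
  | _, bot, t => t
  | _, atom u, t => Lam.app t u
  | _, bool u, t => Lam.app t u
  | _, app u S, t => S.plug (Lam.app t u)
  | _, fst S, t => S.plug (Lam.fst t)
  | _, snd S, t => S.plug (Lam.snd t)

def subst {Γ Δ : List Ty} (σ : Lam.Sub Γ Δ) : {A : Ty} → Stack Γ A → Stack Δ A
  | _, bot => bot
  | _, atom u => atom (u.subst σ)
  | _, bool u => bool (u.subst σ)
  | _, app u S => app (u.subst σ) (S.subst σ)
  | _, fst S => fst (S.subst σ)
  | _, snd S => snd (S.subst σ)

variable {Γ Δ Θ : List Ty} {A : Ty}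

theorem plug_subst (σ : Lam.Sub Γ Δ) (S : Stack Γ A) (t : Lam Γ A.stable) :
    (S.plug t).subst σ = (S.subst σ).plug (t.subst σ) := by
  induction S <;> simp_all [plug, subst, Lam.subst] <;> rfl

theorem subst_comp (σ : Lam.Sub Γ Δ) (τ : Lam.Sub Δ Θ) (S : Stack Γ A) :
    (S.subst σ).subst τ = S.subst (σ.comp τ) := by
  induction S <;> simp_all [subst, Lam.subst_comp]

theorem subst_id (S : Stack Γ A) : S.subst Lam.Sub.id = S := by
  induction S <;> simp_all [subst, Lam.subst_id]

theorem plug_conv (S : Stack Γ A) {t u : Lam Γ A.stable} (h : Lam.Conv t u) :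
    Lam.Conv (S.plug t) (S.plug u) := by
  induction S with
  | bot => exact h
  | atom v => exact .app h (.refl v)
  | bool v => exact .app h (.refl v)
  | app v S ih => exact ih (.app h (.refl v))
  | fst S ih => exact ih (.fst h)
  | snd S ih => exact ih (.snd h)

end Stack

/-! ### Abstraction over stacks -/

/-- A term of type falsum depending on a stack for `A`, in any context reached from `Γ` by a
substitution. -/
abbrev StackFun (Γ : List Ty) (A : Ty) : Type :=
  ∀ ⦃Δ : List Ty⦄, Lam.Sub Γ Δ → Stack Δ A → Lam Δ Ty.bot

namespace StackFun

variable {Γ Δ : List Ty} {A B : Ty}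

/-- Compatibility of a function of stacks with substitution. -/
def Natural (b : StackFun Γ A) : Prop :=
  ∀ ⦃Δ Θ : List Ty⦄ (σ : Lam.Sub Γ Δ) (S : Stack Δ A) (τ : Lam.Sub Δ Θ),
    (b σ S).subst τ = b (σ.comp τ) (S.subst τ)

/-- Reindexing along a substitution. -/
def subst (b : StackFun Γ A) (τ : Lam.Sub Γ Δ) : StackFun Δ A := fun _ σ S => b (τ.comp σ) S

/-- The dependence on the rest of a stack that begins with an argument, the argument being the
innermost variable. -/
def arg (b : StackFun Γ (Ty.arr A B)) : StackFun (A.stable :: Γ) B :=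
  fun _ σ S => b ((Lam.Sub.wk _).comp σ) (.app (σ Var.z) S)

/-- The dependence on the rest of a stack that begins with the first projection. -/
def left (b : StackFun Γ (Ty.and A B)) : StackFun Γ A := fun _ σ S => b σ (.fst S)

/-- The dependence on the rest of a stack that begins with the second projection. -/
def right (b : StackFun Γ (Ty.and A B)) : StackFun Γ B := fun _ σ S => b σ (.snd S)

theorem Natural.subst {b : StackFun Γ A} (hb : b.Natural) (τ : Lam.Sub Γ Δ) :
    (b.subst τ).Natural := fun _ _ σ S υ => by
  rw [StackFun.subst, hb, Lam.Sub.comp_assoc]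
  rfl

theorem Natural.arg {b : StackFun Γ (Ty.arr A B)} (hb : b.Natural) : b.arg.Natural :=
  fun _ _ σ S υ => by
    simp only [StackFun.arg, hb _ _ _, Lam.Sub.comp_assoc, Stack.subst]
    rfl

theorem Natural.left {b : StackFun Γ (Ty.and A B)} (hb : b.Natural) : b.left.Natural :=
  fun _ _ _ _ _ => hb _ _ _

theorem Natural.right {b : StackFun Γ (Ty.and A B)} (hb : b.Natural) : b.right.Natural :=
  fun _ _ _ _ _ => hb _ _ _

/-- The term of type `A.stable` which, plugged into a stack `S`, computes `b S`; it binds the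
components of the stack one at a time. -/
def abs : {A : Ty} → {Γ : List Ty} → StackFun Γ A → Lam Γ A.stable
  | Ty.bot, _, b => b Lam.Sub.id .bot
  | Ty.atom _, _, b => Lam.lam (b (Lam.Sub.wk _) (.atom (Lam.var Var.z)))
  | Ty.bool, _, b => Lam.lam (b (Lam.Sub.wk _) (.bool (Lam.var Var.z)))
  | Ty.arr _ _, _, b => Lam.lam b.arg.abs
  | Ty.and _ _, _, b => Lam.pair b.left.abs b.right.abs

theorem abs_subst {b : StackFun Γ A} (hb : b.Natural) (τ : Lam.Sub Γ Δ) :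
    b.abs.subst τ = (b.subst τ).abs := by
  induction A generalizing Γ Δ with
  | bot =>
    refine (hb _ _ _).trans ?_
    rw [abs, subst, Lam.Sub.comp_id]
    rfl
  | atom n =>
    simp only [abs, Lam.subst, hb _ _ _, Stack.subst, subst, Lam.Sub.wk_comp_lift]
    rfl
  | bool =>
    simp only [abs, Lam.subst, hb _ _ _, Stack.subst, subst, Lam.Sub.wk_comp_lift]
    rfl
  | arr A B _ ih =>
    simp only [abs, Lam.subst, ih hb.arg]
    congr 2
    funext Θ σ S
    simp only [subst, arg, ← Lam.Sub.comp_assoc, Lam.Sub.wk_comp_lift]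
    rfl
  | and A B ihA ihB =>
    simp only [abs, Lam.subst, ihA hb.left, ihB hb.right]
    rfl

theorem abs_conv {b c : StackFun Γ A}
    (h : ∀ ⦃Δ : List Ty⦄ (σ : Lam.Sub Γ Δ) (S : Stack Δ A), Lam.Conv (b σ S) (c σ S)) :
    Lam.Conv b.abs c.abs := by
  induction A generalizing Γ with
  | bot => exact h _ _
  | atom n => exact .lam (h _ _)
  | bool => exact .lam (h _ _)
  | arr A B _ ih => exact .lam (ih fun _ _ _ => h _ _)
  | and A B ihA ihB => exact .pair (ihA fun _ _ _ => h _ _) (ihB fun _ _ _ => h _ _)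

/-- The beta rule for abstraction over stacks. -/
theorem plug_abs (S : Stack Γ A) {b : StackFun Γ A} (hb : b.Natural) :
    Lam.Conv (S.plug b.abs) (b Lam.Sub.id S) := by
  induction S with
  | bot => exact .refl _
  | atom u =>
    have h := Lam.Step.beta (b (Lam.Sub.wk _) (.atom (Lam.var Var.z))) u
    rw [hb, Lam.Sub.wk_comp_single] at h
    exact .step h
  | bool u =>
    have h := Lam.Step.beta (b (Lam.Sub.wk _) (.bool (Lam.var Var.z))) u
    rw [hb, Lam.Sub.wk_comp_single] at h
    exact .step h
  | app u S ih =>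
    have h := Lam.Step.beta b.arg.abs u
    rw [abs_subst hb.arg] at h
    refine (S.plug_conv (.step h)).trans ?_
    have h' := ih (hb.arg.subst (Lam.Sub.single u))
    simp only [subst, arg, Lam.Sub.comp_id, Lam.Sub.wk_comp_single] at h'
    exact h'
  | fst S ih => exact (S.plug_conv (.step (.fst_pair _ _))).trans (ih hb.left)
  | snd S ih => exact (S.plug_conv (.step (.snd_pair _ _))).trans (ih hb.right)

/-- Plugging a fixed term into a stack. -/
def ofTerm (t : Lam Γ A.stable) : StackFun Γ A := fun _ σ S => S.plug (t.subst σ)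

/-- The eta rule for abstraction over stacks; this is where extensionality of functions and pairs
is needed. -/
theorem abs_ofTerm (t : Lam Γ A.stable) : Lam.Conv (ofTerm t).abs t := by
  induction A generalizing Γ with
  | bot => rw [abs, ofTerm, Lam.subst_id]; exact .refl _
  | atom n =>
    exact Lam.conv_eta t
  | bool =>
    exact Lam.conv_eta t
  | arr A B _ ih =>
    refine .trans (.lam ?_) (Lam.conv_eta t)
    have h : (ofTerm t).arg = ofTerm (Lam.app (t.subst (Lam.Sub.wk _)) (Lam.var Var.z)) := by
      funext Δ σ S
      exact congrArg S.plug (Lam.app_var_subst t σ).symm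
    rw [h]
    exact ih _
  | and A B ihA ihB => exact .trans (.pair (ihA (.fst t)) (ihB (.snd t))) (.surj t)

end StackFun

/-- Translated terms are equal as soon as they agree in all stacks. -/
theorem Stack.conv_of_plug {Γ : List Ty} {A : Ty} {t u : Lam Γ A.stable}
    (h : ∀ ⦃Δ : List Ty⦄ (σ : Lam.Sub Γ Δ) (S : Stack Δ A),
      Lam.Conv (S.plug (t.subst σ)) (S.plug (u.subst σ))) : Lam.Conv t u :=
  ((StackFun.abs_ofTerm t).symm.trans (StackFun.abs_conv h)).trans (StackFun.abs_ofTerm u)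

/-! ### Conditionals at translated types -/

namespace Lam

variable {Γ Δ : List Ty}

/-- The continuation `λ b. if b then p else q`. The branches are passed to a closed term, so that
substitution and convertibility pass to them directly. -/
def branch (p q : Lam Γ Ty.bot) : Lam Γ (Ty.neg Ty.bool) :=
  app (app (lam (lam (lam
    (ite (var Var.z) (var (Var.s (Var.s Var.z))) (var (Var.s Var.z)))))) p) q

theorem branch_conv {p p' q q' : Lam Γ Ty.bot} (hp : Conv p p') (hq : Conv q q') :
    Conv (branch p q) (branch p' q') := .app (.app (.refl _) hp) hq

theorem branch_beta (p q : Lam Γ Ty.bot) (b : Lam Γ Ty.bool) :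
    Conv (app (branch p q) b) (ite b p q) := by
  have h₁ := Step.beta
    (lam (lam (ite (var Var.z) (var (Var.s (Var.s Var.z))) (var (Var.s Var.z))))) p
  have h₂ := Step.beta
    (lam (ite (var Var.z) ((p.rename (Ren.wk Ty.bot)).rename (Ren.wk Ty.bool))
      (var (Var.s Var.z)))) q
  have h₃ := Step.beta (ite (var Var.z) (p.rename (Ren.wk Ty.bool)) (q.rename (Ren.wk Ty.bool))) b
  have e₁ : ((p.rename (Ren.wk Ty.bot)).rename (Ren.wk Ty.bool)).subst
      (Sub.lift (Sub.single q) Ty.bool) = p.rename (Ren.wk Ty.bool) := by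
    rw [rename_rename, subst_rename, rename_eq_subst]; rfl
  have e₂ (r : Lam Γ Ty.bot) : (r.rename (Ren.wk Ty.bool)).subst (Sub.single b) = r := by
    rw [subst_rename]; exact subst_var r
  simp only [subst, e₁, e₂] at h₂ h₃
  exact .trans (.app (.trans (.app (.step h₁) (.refl q)) (.step h₂)) (.refl b)) (.step h₃)

/-- A truth value at type `¬ ¬ Bool` is applied to a continuation. -/
theorem ret_tt_beta (k : Lam Γ (Ty.neg Ty.bool)) : Conv (app (ret tt) k) (app k tt) :=
  .step (.beta _ _)

theorem ret_ff_beta (k : Lam Γ (Ty.neg Ty.bool)) : Conv (app (ret ff) k) (app k ff) :=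
  .step (.beta _ _)

variable {A : Ty}

/-- The stack function of a conditional: the stack is copied into both branches. -/
def iteFun (c : Lam Γ (Ty.neg (Ty.neg Ty.bool))) (t u : Lam Γ A.stable) : StackFun Γ A :=
  fun _ σ S => app (c.subst σ) (branch (S.plug (t.subst σ)) (S.plug (u.subst σ)))

theorem iteFun_natural (c : Lam Γ (Ty.neg (Ty.neg Ty.bool))) (t u : Lam Γ A.stable) :
    (iteFun c t u).Natural := fun _ _ σ S τ => by
  simp only [iteFun, branch, subst, subst_comp, Stack.plug_subst]
  rfl

/-- The conditional at a translated type. -/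
def iteStable (c : Lam Γ (Ty.neg (Ty.neg Ty.bool))) (t u : Lam Γ A.stable) : Lam Γ A.stable :=
  (iteFun c t u).abs

theorem iteStable_subst (c : Lam Γ (Ty.neg (Ty.neg Ty.bool))) (t u : Lam Γ A.stable)
    (σ : Sub Γ Δ) :
    (iteStable c t u).subst σ = iteStable (c.subst σ) (t.subst σ) (u.subst σ) := by
  rw [iteStable, StackFun.abs_subst (iteFun_natural c t u), iteStable]
  congr 1
  funext Θ τ S
  simp only [StackFun.subst, iteFun, subst_comp]

theorem iteStable_conv {c c' : Lam Γ (Ty.neg (Ty.neg Ty.bool))} {t t' u u' : Lam Γ A.stable}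
    (hc : ∀ (Δ : List Ty) (σ : Sub Γ Δ), Conv (c.subst σ) (c'.subst σ))
    (ht : ∀ (Δ : List Ty) (σ : Sub Γ Δ), Conv (t.subst σ) (t'.subst σ))
    (hu : ∀ (Δ : List Ty) (σ : Sub Γ Δ), Conv (u.subst σ) (u'.subst σ)) :
    Conv (iteStable c t u) (iteStable c' t' u') :=
  StackFun.abs_conv fun _ σ S => .app (hc _ σ)
    (branch_conv (S.plug_conv (ht _ σ)) (S.plug_conv (hu _ σ)))

theorem plug_iteStable (S : Stack Γ A) (c : Lam Γ (Ty.neg (Ty.neg Ty.bool)))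
    (t u : Lam Γ A.stable) :
    Conv (S.plug (iteStable c t u)) (app c (branch (S.plug t) (S.plug u))) := by
  have h := StackFun.plug_abs S (iteFun_natural c t u)
  simp only [iteFun, subst_id] at h
  exact h

end Lam

/-! ### The translation of the lambda-mu-calculus -/

/-- Values for lambda-variables under the translation. -/
abbrev TermEnv (Γ Θ : List Ty) : Type := ∀ ⦃A : Ty⦄, Var Γ A → Lam Θ A.stable

/-- Values for mu-variables under the translation. -/
abbrev StackEnv (Δ Θ : List Ty) : Type := ∀ ⦃A : Ty⦄, Var Δ A → Stack Θ A

def TermEnv.subst {Γ Θ Ξ : List Ty} (ε : TermEnv Γ Θ) (τ : Lam.Sub Θ Ξ) : TermEnv Γ Ξ :=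
  fun _ x => (ε x).subst τ

def StackEnv.subst {Δ Θ Ξ : List Ty} (κ : StackEnv Δ Θ) (τ : Lam.Sub Θ Ξ) : StackEnv Δ Ξ :=
  fun _ α => (κ α).subst τ

/-- Extension of term values under a binder. -/
def TermEnv.lift {Γ Θ : List Ty} (ε : TermEnv Γ Θ) (C : Ty) : TermEnv (C :: Γ) (C.stable :: Θ) :=
  Var.cons (P := fun A => Lam (C.stable :: Θ) A.stable) (Lam.var Var.z) (ε.subst (Lam.Sub.wk _))

/-- Extension of term values by a value for the innermost variable. -/
def TermEnv.cons {Γ Θ : List Ty} {C : Ty} (t : Lam Θ C.stable) (ε : TermEnv Γ Θ) :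
    TermEnv (C :: Γ) Θ := Var.cons (P := fun A => Lam Θ A.stable) t ε

/-- Extension of stack values by a stack for the innermost mu-variable. -/
def StackEnv.cons {Δ Θ : List Ty} {C : Ty} (S : Stack Θ C) (κ : StackEnv Δ Θ) :
    StackEnv (C :: Δ) Θ := Var.cons (P := Stack Θ) S κ

namespace Mu

/-- The translation of lambda-mu-terms into simply typed terms, relative to values for the
lambda-variables and stacks for the mu-variables: `[α] t` plugs `t` into the stack of `α`, and
`μ α. t` abstracts over the stack of `α`. -/
def trans {Γ Δ : List Ty} {A : Ty} :
    Mu Γ Δ A → {Θ : List Ty} → TermEnv Γ Θ → StackEnv Δ Θ → Lam Θ A.stable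
  | var x, _, ε, _ => ε x
  | lam t, _, ε, κ => Lam.lam (t.trans (ε.lift _) (κ.subst (Lam.Sub.wk _)))
  | app t u, _, ε, κ => Lam.app (t.trans ε κ) (u.trans ε κ)
  | pair t u, _, ε, κ => Lam.pair (t.trans ε κ) (u.trans ε κ)
  | fst t, _, ε, κ => Lam.fst (t.trans ε κ)
  | snd t, _, ε, κ => Lam.snd (t.trans ε κ)
  | tt, _, _, _ => Lam.ret Lam.tt
  | ff, _, _, _ => Lam.ret Lam.ff
  | ite c t u, _, ε, κ => Lam.iteStable (c.trans ε κ) (t.trans ε κ) (u.trans ε κ)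
  | named α t, _, ε, κ => (κ α).plug (t.trans ε κ)
  | mu t, _, ε, κ => StackFun.abs fun _ σ S => t.trans (ε.subst σ) (StackEnv.cons S (κ.subst σ))

/-- The translation of the body of a mu-abstraction, as a function of the stack. -/
def muFun {Γ Δ Θ : List Ty} {A : Ty} (t : Mu Γ (A :: Δ) Ty.bot) (ε : TermEnv Γ Θ)
    (κ : StackEnv Δ Θ) : StackFun Θ A :=
  fun _ σ S => t.trans (ε.subst σ) (StackEnv.cons S (κ.subst σ))

end Mu

section environments

variable {Γ Δ Θ Ξ Ω : List Ty}

theorem TermEnv.subst_subst (ε : TermEnv Γ Θ) (σ : Lam.Sub Θ Ξ) (τ : Lam.Sub Ξ Ω) :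
    (ε.subst σ).subst τ = ε.subst (σ.comp τ) := by
  funext A x; exact Lam.subst_comp _ _ _

theorem TermEnv.subst_id (ε : TermEnv Γ Θ) : ε.subst Lam.Sub.id = ε := by
  funext A x; exact Lam.subst_id _

theorem TermEnv.lift_subst (ε : TermEnv Γ Θ) (C : Ty) (τ : Lam.Sub Θ Ξ) :
    (ε.lift C).subst (τ.lift _) = (ε.subst τ).lift C := by
  funext A x
  cases x with
  | z => rfl
  | s x =>
    refine (Lam.subst_comp _ _ _).trans (Eq.trans ?_ (Lam.subst_comp _ _ _).symm)
    rw [Lam.Sub.wk_comp_lift]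

theorem TermEnv.lift_subst_single (ε : TermEnv Γ Θ) (C : Ty) (u : Lam Θ C.stable) :
    (ε.lift C).subst (Lam.Sub.single u) = TermEnv.cons u ε := by
  funext A x
  cases x with
  | z => rfl
  | s x => exact (Lam.subst_comp _ _ _).trans (Lam.subst_id _)

theorem StackEnv.subst_subst (κ : StackEnv Δ Θ) (σ : Lam.Sub Θ Ξ) (τ : Lam.Sub Ξ Ω) :
    (κ.subst σ).subst τ = κ.subst (σ.comp τ) := by
  funext A x; exact Stack.subst_comp _ _ _

theorem StackEnv.subst_id (κ : StackEnv Δ Θ) : κ.subst Lam.Sub.id = κ := by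
  funext A x; exact Stack.subst_id _

theorem StackEnv.subst_wk_lift (κ : StackEnv Δ Θ) (C : Ty) (τ : Lam.Sub Θ Ξ) :
    (κ.subst (Lam.Sub.wk C)).subst (τ.lift C) = (κ.subst τ).subst (Lam.Sub.wk C) := by
  rw [subst_subst, subst_subst, Lam.Sub.wk_comp_lift]

theorem StackEnv.subst_wk_single (κ : StackEnv Δ Θ) {C : Ty} (u : Lam Θ C) :
    (κ.subst (Lam.Sub.wk C)).subst (Lam.Sub.single u) = κ := by
  rw [subst_subst, Lam.Sub.wk_comp_single, subst_id]

theorem StackEnv.cons_subst {C : Ty} (S : Stack Θ C) (κ : StackEnv Δ Θ) (τ : Lam.Sub Θ Ξ) :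
    (StackEnv.cons S κ).subst τ = StackEnv.cons (S.subst τ) (κ.subst τ) := by
  funext A x; cases x <;> rfl

end environments

namespace Mu

/-- The translation commutes with substitution in the target calculus. -/
theorem trans_subst {Γ Δ : List Ty} {A : Ty} (t : Mu Γ Δ A) :
    ∀ {Θ Ξ : List Ty} (ε : TermEnv Γ Θ) (κ : StackEnv Δ Θ) (τ : Lam.Sub Θ Ξ),
      (t.trans ε κ).subst τ = t.trans (ε.subst τ) (κ.subst τ) := by
  induction t with
  | var | tt | ff => intros; rfl
  | lam t ih =>
    intro Θ Ξ ε κ τ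
    refine congrArg Lam.lam ((ih _ _ _).trans ?_)
    rw [TermEnv.lift_subst, StackEnv.subst_wk_lift]
  | app t u iht ihu =>
    intro Θ Ξ ε κ τ
    exact congrArg₂ Lam.app (iht ε κ τ) (ihu ε κ τ)
  | pair t u iht ihu =>
    intro Θ Ξ ε κ τ
    exact congrArg₂ Lam.pair (iht ε κ τ) (ihu ε κ τ)
  | fst t ih =>
    intro Θ Ξ ε κ τ
    exact congrArg Lam.fst (ih ε κ τ)
  | snd t ih =>
    intro Θ Ξ ε κ τ
    exact congrArg Lam.snd (ih ε κ τ)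
  | ite c t u ihc iht ihu =>
    intro Θ Ξ ε κ τ
    refine (Lam.iteStable_subst _ _ _ _).trans ?_
    rw [iht, ihu]
    exact congrArg (Lam.iteStable · _ _) (ihc ε κ τ)
  | named α t ih =>
    intro Θ Ξ ε κ τ
    refine (Stack.plug_subst _ _ _).trans ?_
    rw [ih]
    rfl
  | mu t ih =>
    intro Θ Ξ ε κ τ
    have hn : (muFun t ε κ).Natural := fun _ _ σ S υ => by
      refine (ih _ _ _).trans ?_
      rw [TermEnv.subst_subst, StackEnv.cons_subst, StackEnv.subst_subst]
      rfl
    refine (StackFun.abs_subst hn τ).trans (congrArg StackFun.abs ?_)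
    funext Ω σ S
    rw [TermEnv.subst_subst, StackEnv.subst_subst]
    rfl

theorem muFun_natural {Γ Δ Θ : List Ty} {A : Ty} (t : Mu Γ (A :: Δ) Ty.bot) (ε : TermEnv Γ Θ)
    (κ : StackEnv Δ Θ) : (muFun t ε κ).Natural := fun _ _ σ S υ => by
  refine (trans_subst t _ _ _).trans ?_
  rw [TermEnv.subst_subst, StackEnv.cons_subst, StackEnv.subst_subst]
  rfl

/-- A mu-abstraction in a stack passes the stack to its mu-variable. -/
theorem plug_mu {Γ Δ Θ : List Ty} {A : Ty} (S : Stack Θ A) (t : Mu Γ (A :: Δ) Ty.bot)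
    (ε : TermEnv Γ Θ) (κ : StackEnv Δ Θ) :
    Lam.Conv (S.plug ((mu t).trans ε κ)) (t.trans ε (StackEnv.cons S κ)) := by
  have h := StackFun.plug_abs S (muFun_natural t ε κ)
  rw [muFun, TermEnv.subst_id, StackEnv.subst_id] at h
  exact h

/-- The translation commutes with renaming in the source calculus. -/
theorem trans_rename {Γ Δ : List Ty} {A : Ty} (t : Mu Γ Δ A) :
    ∀ {Γ' Δ' Θ : List Ty} (ρ : Ren Γ Γ') (θ : Ren Δ Δ') (ε : TermEnv Γ' Θ) (κ : StackEnv Δ' Θ),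
      (t.rename ρ θ).trans ε κ = t.trans (fun _ x => ε (ρ x)) (fun _ α => κ (θ α)) := by
  induction t with
  | lam t ih =>
    intro Γ' Δ' Θ ρ θ ε κ
    refine congrArg Lam.lam ((ih _ _ _ _).trans ?_)
    congr 1
    funext B x; cases x <;> rfl
  | mu t ih =>
    intro Γ' Δ' Θ ρ θ ε κ
    refine congrArg StackFun.abs ?_
    funext Ξ σ S
    refine (ih _ _ _ _).trans ?_
    congr 1
    funext B x; cases x <;> rfl
  | _ => intros; simp_all only [rename, trans] <;> rfl

theorem trans_wkVar {Γ Δ Θ : List Ty} {A C : Ty} (t : Mu Γ Δ A) (ε : TermEnv (C :: Γ) Θ)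
    (κ : StackEnv Δ Θ) : (t.wkVar C).trans ε κ = t.trans (fun _ x => ε x.s) κ :=
  trans_rename t _ _ _ _

theorem trans_wkName {Γ Δ Θ : List Ty} {A C : Ty} (t : Mu Γ Δ A) (ε : TermEnv Γ Θ)
    (κ : StackEnv (C :: Δ) Θ) : (t.wkName C).trans ε κ = t.trans ε (fun _ α => κ α.s) :=
  trans_rename t _ _ _ _

/-- Substitution of lambda-variables in the source becomes a change of their values. -/
theorem trans_subst_var {Γ Δ : List Ty} {A : Ty} (t : Mu Γ Δ A) :
    ∀ {Γ' Θ : List Ty} (s : Sub Γ Γ' Δ) (ε : TermEnv Γ' Θ) (κ : StackEnv Δ Θ),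
      (t.subst s).trans ε κ = t.trans (fun _ x => (s x).trans ε κ) κ := by
  induction t with
  | lam t ih =>
    intro Γ' Θ s ε κ
    refine congrArg Lam.lam ((ih _ _ _).trans ?_)
    congr 1
    funext B x
    cases x with
    | z => rfl
    | s x => exact (trans_wkVar _ _ _).trans (trans_subst _ _ _ _).symm
  | mu t ih =>
    intro Γ' Θ s ε κ
    refine congrArg StackFun.abs ?_
    funext Ξ σ S
    refine (ih _ _ _).trans ?_
    congr 1
    funext B x
    exact (trans_wkName _ _ _).trans (trans_subst _ _ _ _).symm
  | _ => intros; simp_all only [subst, trans] <;> rfl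

/-- The stack obtained by putting a frame on top of a stack. -/
def Frame.toStack {Γ Δ Θ : List Ty} (ε : TermEnv Γ Θ) (κ : StackEnv Δ Θ) :
    {A B : Ty} → Frame Γ Δ A B → Stack Θ B → Stack Θ A
  | _, _, .app u, S => .app (u.trans ε κ) S
  | _, _, .fst, S => .fst S
  | _, _, .snd, S => .snd S
  | _, _, .ite u v, S => .bool (Lam.branch (S.plug (u.trans ε κ)) (S.plug (v.trans ε κ)))

/-- A framed term in a stack is convertible to the term in the stack extended by the frame. -/
theorem Frame.plug_trans {Γ Δ Θ : List Ty} {A B : Ty} (F : Frame Γ Δ A B) (S : Stack Θ B)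
    (t : Mu Γ Δ A) (ε : TermEnv Γ Θ) (κ : StackEnv Δ Θ) :
    Lam.Conv (S.plug ((F.plug t).trans ε κ)) ((F.toStack ε κ S).plug (t.trans ε κ)) := by
  cases F with
  | ite u v => exact Lam.plug_iteStable S _ _ _
  | _ => exact .refl _

theorem Frame.toStack_subst {Γ Δ Θ Ξ : List Ty} {A B : Ty} (F : Frame Γ Δ A B) (S : Stack Θ B)
    (ε : TermEnv Γ Θ) (κ : StackEnv Δ Θ) (τ : Lam.Sub Θ Ξ) :
    (F.toStack ε κ S).subst τ = F.toStack (ε.subst τ) (κ.subst τ) (S.subst τ) := by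
  cases F with
  | app u => exact congrArg (Stack.app · _) (trans_subst u ε κ τ)
  | fst | snd => rfl
  | ite u v =>
    simp only [toStack, Stack.subst, ← trans_subst, ← Stack.plug_subst]
    rfl

theorem Frame.toStack_rename {Γ Δ Γ' Δ' Θ : List Ty} {A B : Ty} (F : Frame Γ Δ A B)
    (S : Stack Θ B) (ρ : Ren Γ Γ') (θ : Ren Δ Δ') (ε : TermEnv Γ' Θ) (κ : StackEnv Δ' Θ) :
    (F.rename ρ θ).toStack ε κ S =
      F.toStack (fun _ x => ε (ρ x)) (fun _ α => κ (θ α)) S := by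
  cases F <;> simp only [Frame.rename, toStack, trans_rename]

/-- The stack by which a structural substitution replaces a mu-variable. -/
def Co.toStack {Γ Δ Θ : List Ty} (ε : TermEnv Γ Θ) (κ : StackEnv Δ Θ) {A : Ty} :
    Co Γ Δ A → Stack Θ A
  | .name β => κ β
  | .push F β => F.toStack ε κ (κ β)

theorem Co.plug_toStack {Γ Δ Θ : List Ty} {A : Ty} (c : Co Γ Δ A) (t : Mu Γ Δ A)
    (ε : TermEnv Γ Θ) (κ : StackEnv Δ Θ) :
    Lam.Conv ((c.apply t).trans ε κ) ((c.toStack ε κ).plug (t.trans ε κ)) := by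
  cases c with
  | name β => exact .refl _
  | push F β => exact F.plug_trans _ _ _ _

theorem Co.toStack_subst {Γ Δ Θ Ξ : List Ty} {A : Ty} (c : Co Γ Δ A)
    (ε : TermEnv Γ Θ) (κ : StackEnv Δ Θ) (τ : Lam.Sub Θ Ξ) :
    (c.toStack ε κ).subst τ = c.toStack (ε.subst τ) (κ.subst τ) := by
  cases c with
  | name β => rfl
  | push F β => exact F.toStack_subst _ _ _ _

theorem Co.toStack_rename {Γ Δ Γ' Δ' Θ : List Ty} {A : Ty} (c : Co Γ Δ A)
    (ρ : Ren Γ Γ') (θ : Ren Δ Δ') (ε : TermEnv Γ' Θ) (κ : StackEnv Δ' Θ) :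
    (c.rename ρ θ).toStack ε κ = c.toStack (fun _ x => ε (ρ x)) (fun _ α => κ (θ α)) := by
  cases c with
  | name β => rfl
  | push F β => exact F.toStack_rename _ _ _ _ _

/-- A structural substitution becomes a substitution of stacks for mu-variables. Only convertibility
holds, because a conditional put on a stack distributes the stack over its branches. -/
theorem trans_cosubst {Γ Δ : List Ty} {A : Ty} (t : Mu Γ Δ A) :
    ∀ {Δ' Θ : List Ty} (c : CoSub Γ Δ Δ') (ε : TermEnv Γ Θ) (κ : StackEnv Δ' Θ),
      Lam.Conv ((t.cosubst c).trans ε κ) (t.trans ε fun _ α => (c α).toStack ε κ) := by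
  induction t with
  | var | tt | ff => intros; exact .refl _
  | lam t ih =>
    intro Δ' Θ c ε κ
    refine .lam ((ih _ _ _).trans ?_)
    convert Lam.Conv.refl _ using 2
    funext B α
    exact (Co.toStack_subst _ _ _ _).trans
      (Co.toStack_rename (c α) (Ren.wk _) (fun _ β => β) (ε.lift _)
        (κ.subst (Lam.Sub.wk _))).symm
  | app t u iht ihu => intros; exact .app (iht _ _ _) (ihu _ _ _)
  | pair t u iht ihu => intros; exact .pair (iht _ _ _) (ihu _ _ _)
  | fst t ih => intros; exact .fst (ih _ _ _)
  | snd t ih => intros; exact .snd (ih _ _ _)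
  | ite b t u ihb iht ihu =>
    intro Δ' Θ c ε κ
    have h (Ξ : List Ty) (σ : Lam.Sub Θ Ξ) :
        StackEnv.subst (fun _ α => (c α).toStack ε κ) σ =
          fun _ α => (c α).toStack (ε.subst σ) (κ.subst σ) := by
      funext B α; exact Co.toStack_subst _ _ _ _
    refine Lam.iteStable_conv (fun Ξ σ => ?_) (fun Ξ σ => ?_) (fun Ξ σ => ?_)
    · refine trans_subst (b.cosubst c) ε κ σ ▸ trans_subst b ε _ σ ▸ ?_
      exact h Ξ σ ▸ ihb c _ _
    · rw [trans_subst, trans_subst, h]; exact iht c _ _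
    · rw [trans_subst, trans_subst, h]; exact ihu c _ _
  | named α t ih =>
    intro Δ' Θ c ε κ
    exact (Co.plug_toStack _ _ _ _).trans (Stack.plug_conv _ (ih _ _ _))
  | mu t ih =>
    intro Δ' Θ c ε κ
    refine StackFun.abs_conv fun Ξ σ S => (ih _ _ _).trans ?_
    convert Lam.Conv.refl _ using 2
    funext B α
    cases α with
    | z => rfl
    | s α =>
      exact (Co.toStack_subst _ _ _ _).trans
        (Co.toStack_rename (c α) (fun _ x => x) (Ren.wk _) (ε.subst σ)
          (StackEnv.cons S (κ.subst σ))).symm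

/-- Two terms have convertible translations if these agree in all stacks. -/
theorem trans_conv_of_plug {Γ Δ : List Ty} {A : Ty} {t u : Mu Γ Δ A}
    (h : ∀ {Θ : List Ty} (ε : TermEnv Γ Θ) (κ : StackEnv Δ Θ) (S : Stack Θ A),
      Lam.Conv (S.plug (t.trans ε κ)) (S.plug (u.trans ε κ)))
    {Θ : List Ty} (ε : TermEnv Γ Θ) (κ : StackEnv Δ Θ) :
    Lam.Conv (t.trans ε κ) (u.trans ε κ) :=
  Stack.conv_of_plug fun Ξ σ S => by
    rw [trans_subst, trans_subst]; exact h _ _ S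

/-- Reduction in the lambda-mu-calculus becomes convertibility. -/
theorem Step.trans_conv {Γ Δ : List Ty} {A : Ty} {t u : Mu Γ Δ A} (h : Step t u) :
    ∀ {Θ : List Ty} (ε : TermEnv Γ Θ) (κ : StackEnv Δ Θ),
      Lam.Conv (t.trans ε κ) (u.trans ε κ) := by
  have sub {Γ Δ : List Ty} {A : Ty} {t u : Mu Γ Δ A}
      (h : ∀ {Θ : List Ty} (ε : TermEnv Γ Θ) (κ : StackEnv Δ Θ),
        Lam.Conv (t.trans ε κ) (u.trans ε κ))
      {Θ : List Ty} (ε : TermEnv Γ Θ) (κ : StackEnv Δ Θ) (Ξ : List Ty) (σ : Lam.Sub Θ Ξ) :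
      Lam.Conv ((t.trans ε κ).subst σ) ((u.trans ε κ).subst σ) := by
    rw [trans_subst, trans_subst]; exact h _ _
  induction h with
  | beta t u =>
    intro Θ ε κ
    have h := Lam.Step.beta (t.trans (ε.lift _) (κ.subst (Lam.Sub.wk _))) (u.trans ε κ)
    rw [trans_subst, TermEnv.lift_subst_single, StackEnv.subst_wk_single] at h
    refine .trans (.step h) ?_
    rw [trans_subst_var]
    convert Lam.Conv.refl _ using 2
    funext B x; cases x <;> rfl
  | fst_pair t u => intros; exact .step (.fst_pair _ _)
  | snd_pair t u => intros; exact .step (.snd_pair _ _)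
  | ite_tt t u =>
    intro Θ ε κ
    refine trans_conv_of_plug (fun ε κ S => (Lam.plug_iteStable _ _ _ _).trans ?_) ε κ
    exact (Lam.ret_tt_beta _).trans ((Lam.branch_beta _ _ _).trans (.step (.ite_tt _ _)))
  | ite_ff t u =>
    intro Θ ε κ
    refine trans_conv_of_plug (fun ε κ S => (Lam.plug_iteStable _ _ _ _).trans ?_) ε κ
    exact (Lam.ret_ff_beta _).trans ((Lam.branch_beta _ _ _).trans (.step (.ite_ff _ _)))
  | @struct Γ Δ A B F t =>
    -- in a stack `S`, both sides become `t` with the frame on top of `S` as the stack of `α`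
    intro Θ ε κ
    refine trans_conv_of_plug (fun ε κ S => ?_) ε κ
    refine (F.plug_trans S _ ε κ).trans ((plug_mu _ _ _ _).trans (.symm ?_))
    refine (plug_mu _ _ _ _).trans ((trans_cosubst _ _ _ _).trans ?_)
    convert Lam.Conv.refl _ using 2
    funext C α
    cases α with
    | z => exact (F.toStack_rename S (fun _ x => x) (Ren.wk _) ε (StackEnv.cons S κ)).symm
    | s α => rfl
  | mu_eta t =>
    intro Θ ε κ
    refine trans_conv_of_plug (fun ε κ S => (plug_mu _ _ _ _).trans ?_) ε κ
    refine S.plug_conv ?_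
    rw [trans_wkName]
    exact .refl _
  | lam _ ih => intros; exact .lam (ih _ _)
  | appL _ ih => intros; exact .app (ih _ _) (.refl _)
  | appR _ ih => intros; exact .app (.refl _) (ih _ _)
  | pairL _ ih => intros; exact .pair (ih _ _) (.refl _)
  | pairR _ ih => intros; exact .pair (.refl _) (ih _ _)
  | fst _ ih => intros; exact .fst (ih _ _)
  | snd _ ih => intros; exact .snd (ih _ _)
  | iteC _ ih =>
    exact fun ε κ => Lam.iteStable_conv (sub ih ε κ) (fun _ _ => .refl _) fun _ _ => .refl _
  | iteT _ ih =>
    exact fun ε κ => Lam.iteStable_conv (fun _ _ => .refl _) (sub ih ε κ) fun _ _ => .refl _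
  | iteE _ ih =>
    exact fun ε κ => Lam.iteStable_conv (fun _ _ => .refl _) (fun _ _ => .refl _) (sub ih ε κ)
  | named _ ih => intros; exact Stack.plug_conv _ (ih _ _)
  | mu _ ih => intros; exact StackFun.abs_conv fun _ _ _ => ih _ _
  | _ =>
    -- the remaining case is `[β] μ α. t ↦ t[β/α]`
    rename_i Γ Δ A β t
    intro Θ ε κ
    refine (plug_mu _ _ _ _).trans ?_
    have e : StackEnv.cons (κ β) κ = fun _ α => κ (Ren.inst β α) := by
      funext C α; cases α <;> rfl
    rw [trans_rename, e]
    exact .refl _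

theorem Steps.trans_conv {Γ Δ Θ : List Ty} {A : Ty} {t u : Mu Γ Δ A} (h : Steps t u)
    (ε : TermEnv Γ Θ) (κ : StackEnv Δ Θ) : Lam.Conv (t.trans ε κ) (u.trans ε κ) := by
  induction h with
  | refl => exact .refl _
  | tail _ h ih => exact ih.trans (h.trans_conv ε κ)

/-- The translation of terms without free mu-variables. -/
def embed (Γ : List Ty) (A : Ty) (t : Mu Γ [] A) : Lam (Γ.map Ty.stable) A.stable :=
  t.trans (fun _ x => Lam.var (x.mapTy Ty.stable)) (fun _ α => nomatch α)

theorem isMuEmbedding_embed : IsMuEmbedding embed := by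
  refine ⟨fun _ _ _ => rfl, fun Γ A B t => ?_, fun _ _ _ _ _ => rfl, fun _ _ _ _ _ => rfl,
    fun _ _ _ _ => rfl, fun _ _ _ _ => rfl, fun _ => rfl, fun _ => rfl,
    fun _ _ _ _ h => h.trans_conv _ _⟩
  refine congrArg Lam.lam ?_
  unfold embed
  congr 1
  · funext C x; cases x <;> rfl
  · funext C α; cases α

end Mu

/-! ### Parallel OR in the parallel calculus -/

namespace CL

theorem rename_rename {Γ : List Ty} {A : Ty} (t : CL Γ A) :
    ∀ {Δ Θ : List Ty} (ρ : Ren Γ Δ) (θ : Ren Δ Θ),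
      (t.rename ρ).rename θ = t.rename fun _ x => θ (ρ x) := by
  induction t with
  | lam t ih =>
    intro Δ Θ ρ θ
    simp only [rename, ih]
    congr 2; funext B x; cases x <;> rfl
  | em t u iht ihu =>
    intro Δ Θ ρ θ
    simp only [rename, iht, ihu]
    congr 2 <;> (funext B x; cases x <;> rfl)
  | _ => intros; simp_all only [rename]

theorem subst_eq_rename {Γ : List Ty} {A : Ty} (t : CL Γ A) :
    ∀ {Δ Θ : List Ty} (ρ : Ren Γ Δ) (σ : Sub Δ Θ) (θ : Ren Γ Θ),
      (∀ ⦃B : Ty⦄ (x : Var Γ B), σ (ρ x) = var (θ x)) → (t.rename ρ).subst σ = t.rename θ := by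
  have lift {Γ Δ Θ : List Ty} {ρ : Ren Γ Δ} {σ : Sub Δ Θ} {θ : Ren Γ Θ}
      (h : ∀ ⦃B : Ty⦄ (x : Var Γ B), σ (ρ x) = var (θ x)) (C : Ty) ⦃B : Ty⦄
      (x : Var (C :: Γ) B) : σ.lift C (ρ.lift C x) = var (θ.lift C x) := by
    cases x with
    | z => rfl
    | s x => exact congrArg (wk C) (h x)
  induction t with
  | var x => exact fun ρ σ θ h => h x
  | lam t ih => exact fun ρ σ θ h => congrArg lam (ih _ _ _ (lift h _))
  | em t u iht ihu =>
    exact fun ρ σ θ h => congrArg₂ em (iht _ _ _ (lift h _)) (ihu _ _ _ (lift h _))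
  | app t u iht ihu => exact fun ρ σ θ h => congrArg₂ app (iht _ _ _ h) (ihu _ _ _ h)
  | pair t u iht ihu => exact fun ρ σ θ h => congrArg₂ pair (iht _ _ _ h) (ihu _ _ _ h)
  | par t u iht ihu => exact fun ρ σ θ h => congrArg₂ par (iht _ _ _ h) (ihu _ _ _ h)
  | fst t ih => exact fun ρ σ θ h => congrArg fst (ih _ _ _ h)
  | snd t ih => exact fun ρ σ θ h => congrArg snd (ih _ _ _ h)
  | efq P hP t ih => exact fun ρ σ θ h => congrArg (efq P hP) (ih _ _ _ h)
  | tt | ff => intros; rfl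
  | ite c t u ihc iht ihu =>
    intro Δ Θ ρ σ θ h
    simp only [rename, subst, ihc ρ σ θ h, iht ρ σ θ h, ihu ρ σ θ h]

theorem wk_wk_subst_single {Γ : List Ty} {A B C : Ty} (t : CL Γ A) (v : CL Γ C) :
    ((t.wk C).wk B).subst ((Sub.single v).lift B) = t.wk B := by
  rw [wk, wk, rename_rename]
  exact subst_eq_rename t _ _ _ fun _ _ => rfl

/-- The closed term `λ x y. (if y then T else efq (ā x)) ∥_a (if x then T else a)`. -/
def parallelOr : CL [] (Ty.arr Ty.bool (Ty.arr Ty.bool Ty.bool)) :=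
  lam (lam (em (A := Ty.bool)
    (ite (var (Var.s Var.z)) tt
      (efq Ty.bool trivial (app (var Var.z) (var (Var.s (Var.s Var.z))))))
    (ite (var (Var.s (Var.s Var.z))) tt (var Var.z))))

/-- The body of `parallelOr` for the arguments `u` and `v`. -/
def orBody {Γ : List Ty} (u v : CL Γ Ty.bool) : CL Γ Ty.bool :=
  em (A := Ty.bool) (ite (v.wk _) tt (efq Ty.bool trivial (app (var Var.z) (u.wk _))))
    (ite (u.wk _) tt (var Var.z))

theorem parallelOr_steps {Γ : List Ty} (ρ : Ren [] Γ) (u v : CL Γ Ty.bool) :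
    Steps (app (app (parallelOr.rename ρ) u) v) (orBody u v) := by
  refine .tail (.single (.ctx (.appL .hole v) (.beta _ u))) ?_
  have h := Red.beta (em (A := Ty.bool)
    (ite (var (Var.s Var.z)) tt
      (efq Ty.bool trivial (app (var Var.z) ((u.wk Ty.bool).wk (Ty.neg Ty.bool)))))
    (ite ((u.wk Ty.bool).wk Ty.bool) tt (var Var.z))) v
  simp only [subst, wk_wk_subst_single] at h
  exact .ctx .hole h

theorem Step.em_left {Γ : List Ty} {A B : Ty} {u u' : CL (Ty.neg A :: Γ) B} (v : CL (A :: Γ) B)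
    (h : Red u u') : Step (em u v) (em u' v) := .ctx (.emL .hole v) h

theorem Step.em_right {Γ : List Ty} {A B : Ty} (u : CL (Ty.neg A :: Γ) B) {v v' : CL (A :: Γ) B}
    (h : Red v v') : Step (em u v) (em u v') := .ctx (.emR u .hole) h

/-- In a closed term of type `Bool`, a channel of kind `Bool` has positive complexity. -/
theorem commComplexity_closed_bool (u : CL [Ty.neg Ty.bool] Ty.bool) (v : CL [Ty.bool] Ty.bool) :
    0 < commComplexity u v := by
  have h : ∀ C ∈ (em u v).freeTypes, ¬ Ty.bool.StrongSubf C := fun C ⟨x, _⟩ => nomatch x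
  have hp : ¬ Ty.bool.ProperSubf Ty.bool := fun h => h.2 rfl
  unfold commComplexity
  rw [List.filter_eq_self.2]
  · exact Nat.one_pos
  · intro F hF
    obtain rfl : F = Ty.bool := List.mem_singleton.1 hF
    simp only [decide_eq_true_eq]
    exact ⟨hp, h⟩

/-- If one argument is `T`, one side of the channel reduces to `T`, which does not use the channel,
so that the other side, with the unknown argument, is discarded. -/
theorem isParallelOr_parallelOr : parallelOr.IsParallelOr := by
  refine ⟨?_, fun Δ ρ u => ⟨?_, ?_⟩⟩
  · refine .trans (parallelOr_steps (fun _ x => x) ff ff) ?_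
    refine .head (.em_left _ (.ite_ff _ _)) ?_
    refine .head (.em_right _ (.ite_ff _ _)) ?_
    -- the left side sends its first argument, `F`, along the channel; the right side returns it
    refine .single (.ctx .hole (.basicCross (.efq Ty.bool trivial .hole) ff (var Var.z) ?_))
    exact commComplexity_closed_bool _ _
  · refine .trans (parallelOr_steps ρ u tt) ?_
    refine .head (.em_left _ (.ite_tt _ _)) ?_
    exact .single (.ctx .hole (.crossL tt _))
  · refine .trans (parallelOr_steps ρ tt u) ?_
    refine .head (.em_right _ (.ite_tt _ _)) ?_
    exact .single (.ctx .hole (.crossR _ tt))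

end CL

/-! ### A model with undefined truth values -/

/-- The full type hierarchy over the truth values extended by an undefined one, `none`, which
interprets all of the atoms, falsum and the Boolean type. -/
def Ty.Den : Ty → Type
  | Ty.arr A B => A.Den → B.Den
  | Ty.and A B => A.Den × B.Den
  | _ => Option Bool

/-- The undefined element. -/
def Ty.undef : (A : Ty) → A.Den
  | Ty.arr _ B => fun _ => B.undef
  | Ty.and A B => (A.undef, B.undef)
  | Ty.atom _ => (none : Option Bool)
  | Ty.bot => (none : Option Bool)
  | Ty.bool => (none : Option Bool)

/-- The conditional, which is undefined if the condition is. -/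
def Ty.cond : (A : Ty) → Option Bool → A.Den → A.Den → A.Den
  | A, none, _, _ => A.undef
  | _, some true, x, _ => x
  | _, some false, _, y => y

/-- Relatedness of three truth values: one of the first two is undefined, or all are equal. -/
def TruthRel (a b c : Option Bool) : Prop := a = none ∨ b = none ∨ (a = b ∧ b = c)

/-- The logical relation over `TruthRel`. -/
def Ty.Rel : (A : Ty) → A.Den → A.Den → A.Den → Prop
  | Ty.arr A B => fun f g h => ∀ x y z, A.Rel x y z → B.Rel (f x) (g y) (h z)
  | Ty.and A B => fun p q r => A.Rel p.1 q.1 r.1 ∧ B.Rel p.2 q.2 r.2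
  | Ty.atom _ => TruthRel
  | Ty.bot => TruthRel
  | Ty.bool => TruthRel

theorem Ty.rel_undef_left (A : Ty) (y z : A.Den) : A.Rel A.undef y z := by
  induction A with
  | arr A B _ ih => exact fun _ _ _ _ => ih _ _
  | and A B ihA ihB => exact ⟨ihA _ _, ihB _ _⟩
  | _ => exact .inl rfl

theorem Ty.rel_undef_middle (A : Ty) (x z : A.Den) : A.Rel x A.undef z := by
  induction A with
  | arr A B _ ih => exact fun _ _ _ _ => ih _ _
  | and A B ihA ihB => exact ⟨ihA _ _, ihB _ _⟩
  | _ => exact .inr (.inl rfl)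

theorem Ty.rel_cond {A : Ty} {a b c : Option Bool} {x y z x' y' z' : A.Den}
    (h : TruthRel a b c) (hx : A.Rel x y z) (hx' : A.Rel x' y' z') :
    A.Rel (A.cond a x x') (A.cond b y y') (A.cond c z z') := by
  rcases h with rfl | rfl | ⟨rfl, rfl⟩
  · exact A.rel_undef_left _ _
  · exact A.rel_undef_middle _ _
  · match a with
    | none => exact A.rel_undef_left _ _
    | some true => exact hx
    | some false => exact hx'

/-- Environments for the variables of a context. -/
abbrev DenEnv (Γ : List Ty) : Type := ∀ ⦃A : Ty⦄, Var Γ A → A.Den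

/-- Extension of an environment by a value for the innermost variable. -/
def DenEnv.cons {Γ : List Ty} {C : Ty} (a : C.Den) (η : DenEnv Γ) : DenEnv (C :: Γ) :=
  Var.cons (P := Ty.Den) a η

namespace Lam

/-- The value of a term. -/
def den {Γ : List Ty} {A : Ty} : Lam Γ A → DenEnv Γ → A.Den
  | var x, η => η x
  | lam t, η => fun a => t.den (DenEnv.cons a η)
  | app t u, η => t.den η (u.den η)
  | pair t u, η => (t.den η, u.den η)
  | fst t, η => (t.den η).1
  | snd t, η => (t.den η).2
  | efq P _ _, _ => P.undef
  | tt, _ => some true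
  | ff, _ => some false
  | ite c t u, η => Ty.cond _ (c.den η) (t.den η) (u.den η)

theorem den_rename {Γ : List Ty} {A : Ty} (t : Lam Γ A) :
    ∀ {Δ : List Ty} (ρ : Ren Γ Δ) (η : DenEnv Δ),
      (t.rename ρ).den η = t.den fun _ x => η (ρ x) := by
  induction t with
  | @lam Γ A B t ih =>
    intro Δ ρ η
    funext a
    refine (ih _ _).trans (congrArg t.den ?_)
    funext B x; cases x <;> rfl
  | app t u iht ihu => exact fun ρ η => congr (iht ρ η) (ihu ρ η)
  | pair t u iht ihu => exact fun ρ η => congrArg₂ Prod.mk (iht ρ η) (ihu ρ η)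
  | fst t ih => exact fun ρ η => congrArg Prod.fst (ih ρ η)
  | snd t ih => exact fun ρ η => congrArg Prod.snd (ih ρ η)
  | ite c t u ihc iht ihu => intros; simp only [rename, den, ihc, iht, ihu]
  | _ => intros; rfl

theorem den_subst {Γ : List Ty} {A : Ty} (t : Lam Γ A) :
    ∀ {Δ : List Ty} (σ : Sub Γ Δ) (η : DenEnv Δ),
      (t.subst σ).den η = t.den fun _ x => (σ x).den η := by
  induction t with
  | @lam Γ A B t ih =>
    intro Δ σ η
    funext a
    refine (ih _ _).trans (congrArg t.den ?_)
    funext B x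
    cases x with
    | z => rfl
    | s x => exact den_rename _ _ _
  | app t u iht ihu => exact fun σ η => congr (iht σ η) (ihu σ η)
  | pair t u iht ihu => exact fun σ η => congrArg₂ Prod.mk (iht σ η) (ihu σ η)
  | fst t ih => exact fun σ η => congrArg Prod.fst (ih σ η)
  | snd t ih => exact fun σ η => congrArg Prod.snd (ih σ η)
  | ite c t u ihc iht ihu => intros; simp only [subst, den, ihc, iht, ihu]
  | _ => intros; rfl

theorem Step.den_eq {Γ : List Ty} {A : Ty} {t u : Lam Γ A} (h : Step t u) :
    ∀ η : DenEnv Γ, t.den η = u.den η := by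
  induction h with
  | beta t u =>
    intro η
    refine Eq.trans (congrArg t.den ?_) (den_subst t _ η).symm
    funext B x; cases x <;> rfl
  | lam _ ih => exact fun η => funext fun a => ih _
  | appL _ ih => exact fun η => congrFun (ih η) _
  | appR _ ih => exact fun η => congrArg _ (ih η)
  | pairL _ ih => exact fun η => congrArg (·, _) (ih η)
  | pairR _ ih => exact fun η => congrArg (_, ·) (ih η)
  | fst _ ih => exact fun η => congrArg Prod.fst (ih η)
  | snd _ ih => exact fun η => congrArg Prod.snd (ih η)
  | iteC _ ih => intros; simp only [den, ih]
  | iteT _ ih => intros; simp only [den, ih]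
  | iteE _ ih => intros; simp only [den, ih]
  | _ => intros; rfl

theorem Conv.den_eq {Γ : List Ty} {A : Ty} {t u : Lam Γ A} (h : Conv t u) :
    ∀ η : DenEnv Γ, t.den η = u.den η := by
  induction h with
  | step h => exact h.den_eq
  | eta t => exact fun η => funext fun a => congrFun (den_rename t _ (DenEnv.cons a η)) a
  | symm _ ih => exact fun η => (ih η).symm
  | trans _ _ ih ih' => exact fun η => (ih η).trans (ih' η)
  | lam _ ih => exact fun η => funext fun a => ih _
  | app _ _ ih ih' => intros; simp only [den, ih, ih']
  | pair _ _ ih ih' => exact fun η => congrArg₂ Prod.mk (ih η) (ih' η)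
  | fst _ ih => exact fun η => congrArg Prod.fst (ih η)
  | snd _ ih => exact fun η => congrArg Prod.snd (ih η)
  | ite _ _ _ ihc iht ihu => intros; simp only [den, ihc, iht, ihu]
  | _ => intros; rfl

theorem Steps.conv {Γ : List Ty} {A : Ty} {t u : Lam Γ A} (h : Steps t u) : Conv t u := by
  induction h with
  | refl => exact .refl _
  | tail _ h ih => exact ih.trans (.step h)

/-- The fundamental lemma of the logical relation. -/
theorem rel_den {Γ : List Ty} {A : Ty} (t : Lam Γ A) :
    ∀ {η₁ η₂ η₃ : DenEnv Γ}, (∀ ⦃B : Ty⦄ (x : Var Γ B), B.Rel (η₁ x) (η₂ x) (η₃ x)) →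
      A.Rel (t.den η₁) (t.den η₂) (t.den η₃) := by
  induction t with
  | var x => exact fun h => h x
  | lam t ih =>
    intro η₁ η₂ η₃ h a b c habc
    refine ih fun B x => ?_
    cases x with
    | z => exact habc
    | s x => exact h x
  | app t u iht ihu => exact fun h => iht h _ _ _ (ihu h)
  | pair t u iht ihu => exact fun h => ⟨iht h, ihu h⟩
  | fst t ih => exact fun h => (ih h).1
  | snd t ih => exact fun h => (ih h).2
  | efq P hP t => exact fun _ => P.rel_undef_left _ _
  | tt | ff => exact fun _ => .inr (.inr ⟨rfl, rfl⟩)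
  | ite c t u ihc iht ihu => exact fun h => Ty.rel_cond (ihc h) (iht h) (ihu h)

theorem rel_den_undef {Γ : List Ty} {A : Ty} (t : Lam Γ A) :
    A.Rel (t.den fun B _ => B.undef) (t.den fun B _ => B.undef) (t.den fun B _ => B.undef) :=
  t.rel_den fun B _ => B.rel_undef_left _ _

end Lam

/-! ### No parallel OR without communication -/

/-- The triples `(⊥, T, F)` and `(T, ⊥, F)` are related, but `(T, T, F)` is not. -/
theorem not_truthRel : ¬ TruthRel (some true) (some true) (some false) := by
  simp [TruthRel]

/-- A parallel OR is applied to an undefined argument by means of a fresh variable. -/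
theorem Lam.not_isParallelOr {Γ : List Ty}
    (O : Lam Γ (Ty.arr Ty.bool (Ty.arr Ty.bool Ty.bool))) : ¬ O.IsParallelOr := by
  rintro ⟨hff, h⟩
  let f := O.den fun B _ => B.undef
  obtain ⟨h₁, h₂⟩ := h (Ty.bool :: Γ) (Ren.wk _) (var Var.z)
  have e : (O.rename (Ren.wk Ty.bool)).den (fun B _ => B.undef) = f := den_rename O _ _
  have e₁ : f none (some true) = some true := by
    have := h₁.conv.den_eq fun B _ => B.undef
    simp only [den, e] at this
    exact this
  have e₂ : f (some true) none = some true := by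
    have := h₂.conv.den_eq fun B _ => B.undef
    simp only [den, e] at this
    exact this
  have e₃ : f (some false) (some false) = some false := hff.conv.den_eq fun B _ => B.undef
  have hr := O.rel_den_undef none (some true) (some false) (.inl rfl)
    (some true) none (some false) (.inr (.inl rfl))
  change TruthRel (f none (some true)) (f (some true) none) (f (some false) (some false)) at hr
  rw [e₁, e₂, e₃] at hr
  exact not_truthRel hr

/-- If falsum has an element, every type has a stack. -/
def Stack.ofBot {Γ : List Ty} (f : Lam Γ Ty.bot) : (A : Ty) → Stack Γ A
  | Ty.bot => .bot
  | Ty.atom n => .atom (Lam.efq (Ty.atom n) trivial f)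
  | Ty.bool => .bool (Lam.lam (f.rename (Ren.wk _)))
  | Ty.arr _ B => .app (StackFun.abs fun _ σ _ => f.subst σ) (Stack.ofBot f B)
  | Ty.and A _ => .fst (Stack.ofBot f A)

/-- A parallel OR is translated, over a variable of type falsum, into a term that behaves like a
parallel OR on `¬ ¬ Bool`. Applied to the identity continuation, it contradicts the logical
relation on the model in the same way as a simply typed parallel OR. -/
theorem Mu.not_isParallelOr {Γ Δ : List Ty}
    (O : Mu Γ Δ (Ty.arr Ty.bool (Ty.arr Ty.bool Ty.bool))) : ¬ O.IsParallelOr := by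
  rintro ⟨hff, h⟩
  let f : Lam [Ty.bot] Ty.bot := Lam.var Var.z
  let ε : TermEnv Γ [Ty.bot] := fun A _ => StackFun.abs fun _ σ _ => f.subst σ
  let κ : StackEnv Δ [Ty.bot] := fun A _ => Stack.ofBot f A
  let O' := O.trans ε κ
  let u : Lam [Ty.bot] Ty.bool.stable := Lam.lam (Lam.var (Var.s Var.z))
  obtain ⟨h₁, h₂⟩ := h (Ty.bool :: Γ) Δ (Ren.wk _) (fun _ α => α) (var Var.z)
  replace h₁ := (h₁.trans_conv (TermEnv.cons u ε) κ).den_eq fun B _ => B.undef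
  replace h₂ := (h₂.trans_conv (TermEnv.cons u ε) κ).den_eq fun B _ => B.undef
  replace hff := (hff.trans_conv ε κ).den_eq fun B _ => B.undef
  have e : (O.rename (Ren.wk Ty.bool) (fun _ α => α)).trans (TermEnv.cons u ε) κ = O' :=
    trans_rename O _ _ _ _
  simp only [trans, e] at h₁ h₂ hff
  let U : (Option Bool → Option Bool) → Option Bool := fun _ => none
  let T : (Option Bool → Option Bool) → Option Bool := fun k => k (some true)
  let F : (Option Bool → Option Bool) → Option Bool := fun k => k (some false)
  let g : ((Option Bool → Option Bool) → Option Bool) →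
      ((Option Bool → Option Bool) → Option Bool) →
      (Option Bool → Option Bool) → Option Bool := O'.den fun B _ => B.undef
  have e₁ : g U T id = some true := congrFun h₁ id
  have e₂ : g T U id = some true := congrFun h₂ id
  have e₃ : g F F id = some false := congrFun hff id
  have hr : TruthRel (g U T id) (g T U id) (g F F id) :=
    O'.rel_den_undef U T F (fun _ _ _ _ => .inl rfl) T U F (fun _ _ _ _ => .inr (.inl rfl))
      id id id (fun _ _ _ h => h)
  rw [e₁, e₂, e₃] at hr
  exact not_truthRel hr

end ParCalc

theorem mainTheorem3 :
    -- the simply typed lambda-calculus is embedded in the parallel calculus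
    (∀ (Γ : List Ty) (A : Ty),
      Function.Injective (Lam.toCL : Lam Γ A → CL Γ A) ∧
      ∀ (t : Lam Γ A) (r : CL Γ A), CL.Step t.toCL r ↔ ∃ u : Lam Γ A, Lam.Step t u ∧ u.toCL = r) ∧
    -- the lambda-mu-calculus is embedded in the simply typed lambda-calculus
    (∃ e : ∀ (Γ : List Ty) (A : Ty), Mu Γ [] A → Lam (Γ.map Ty.stable) A.stable,
      IsMuEmbedding e) ∧
    -- parallel OR is definable in the parallel calculus by a closed term
    (∃ O : CL [] (Ty.arr Ty.bool (Ty.arr Ty.bool Ty.bool)), O.IsParallelOr) ∧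
    -- but not in the simply typed lambda-calculus, not even by an open term
    (¬ ∃ (Γ : List Ty) (O : Lam Γ (Ty.arr Ty.bool (Ty.arr Ty.bool Ty.bool))), O.IsParallelOr) ∧
    -- nor in the lambda-mu-calculus
    (¬ ∃ (Γ Δ : List Ty) (O : Mu Γ Δ (Ty.arr Ty.bool (Ty.arr Ty.bool Ty.bool))),
      O.IsParallelOr) :=
  ⟨fun _ _ => ⟨Lam.toCL_injective, Lam.toCL_step_iff⟩,
    ⟨Mu.embed, Mu.isMuEmbedding_embed⟩,
    ⟨CL.parallelOr, CL.isParallelOr_parallelOr⟩,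
    fun ⟨_, O, hO⟩ => O.not_isParallelOr hO,
    fun ⟨_, _, O, hO⟩ => O.not_isParallelOr hO⟩
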